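/- Let $M$ be a connected complex manifold of complex dimension $2$, with holomorphic tangent bundle $T'M$, local complex coordinates $(z^k,\eta^k)$ on $T'M$ induced by charts of $M$, and $\widetilde{T'M}=T'M\setminus\{0\}$ the complement of the zero section. Let $(M,F)$ be a complex Finsler space: $F:T'M\to[0,\infty)$ is continuous, $L:=F^2$ is smooth on $\widetilde{T'M}$, $F(z,\eta)=0$ if and only if $\eta=0$, $F(z,\lambda\eta)=|\lambda|F(z,\eta)$ for all $\lambda\in\mathbb C$, and the Hermitian matrix $g_{i\bar j}:=\partial^2L/\partial\eta^i\partial\bar\eta^j$ is positive definite on $\widetilde{T'M}$. Let $(g^{\bar m k})$ be the inverse of $(g_{k\bar m})$, and put (summing over repeated indices) $$N_j^k=g^{\bar m k}\frac{\partial g_{l\bar m}}{\partial z^j}\eta^l,\qquad \delta_k=\frac{\partial}{\partial z^k}-N_k^j\frac{\partial}{\partial\eta^j},\qquad \delta_{\bar k}=\overline{\delta_k},$$ $$L^i_{jk}=g^{\bar l i}\delta_k g_{j\bar l},\qquad C^i_{jk}=g^{\bar l i}\frac{\partial g_{j\bar l}}{\partial\eta^k},\qquad T^i_{jk}=L^i_{jk}-L^i_{kj},$$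 $$R^i_{j\bar h k}=-\delta_{\bar h}L^i_{jk}-\delta_{\bar h}(N^l_k)\,C^i_{jl},\qquad R_{\bar r j\bar h k}=g_{l\bar r}R^l_{j\bar h k}.$$ The space is called Kähler if $T^i_{jk}\eta^j=0$ on $\widetilde{T'M}$. Suppose that for some function $\mathcal K:T'M\to\mathbb R$ $$R_{\bar r j\bar h k}=\mathcal K\,(g_{j\bar r}g_{k\bar h}+g_{k\bar r}g_{j\bar h})\quad\text{on }\widetilde{T'M},$$ and that $\mathcal K$ is not identically zero on $\widetilde{T'M}$. Then $\mathcal K$ is constant on $\widetilde{T'M}$ if and only if $(M,F)$ is Kähler. -/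

import Mathlib

open scoped Manifold ContDiff ComplexOrder

/-! ## Local complex coordinates

In a chart of an `n`-dimensional complex manifold `M`, the holomorphic tangent bundle `T'M` has
the complex coordinates `(z, η)`, a point of `ℂⁿ × ℂⁿ`. -/

namespace CFinsler

/-- The coordinate space `ℂⁿ` (only its topology and linear structure matter). -/
abbrev CSpace (n : ℕ) : Type := Fin n → ℂ

noncomputable section

section Wirtinger

variable {n : ℕ}

/-- The Wirtinger derivative `½ (∂_v - i ∂_{iv}) f` in the direction `v`. -/
def wirtinger (v : CSpace n × CSpace n) (f : CSpace n × CSpace n → ℂ)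
    (p : CSpace n × CSpace n) : ℂ :=
  (fderiv ℝ f p v - Complex.I * fderiv ℝ f p (Complex.I • v)) / 2

/-- The conjugate Wirtinger derivative `½ (∂_v + i ∂_{iv}) f` in the direction `v`. -/
def wirtingerBar (v : CSpace n × CSpace n) (f : CSpace n × CSpace n → ℂ)
    (p : CSpace n × CSpace n) : ℂ :=
  (fderiv ℝ f p v + Complex.I * fderiv ℝ f p (Complex.I • v)) / 2

/-- `∂f/∂z^k`. -/
def dz (k : Fin n) (f : CSpace n × CSpace n → ℂ) : CSpace n × CSpace n → ℂ :=
  wirtinger (Pi.single k 1, 0) f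

/-- `∂f/∂z̄^k`. -/
def dzBar (k : Fin n) (f : CSpace n × CSpace n → ℂ) : CSpace n × CSpace n → ℂ :=
  wirtingerBar (Pi.single k 1, 0) f

/-- `∂f/∂η^k`. -/
def dEta (k : Fin n) (f : CSpace n × CSpace n → ℂ) : CSpace n × CSpace n → ℂ :=
  wirtinger (0, Pi.single k 1) f

/-- `∂f/∂η̄^k`. -/
def dEtaBar (k : Fin n) (f : CSpace n × CSpace n → ℂ) : CSpace n × CSpace n → ℂ :=
  wirtingerBar (0, Pi.single k 1) f

end Wirtinger

/-! ## The Chern-Finsler connection in coordinates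

Throughout, `L : ℂⁿ × ℂⁿ → ℝ` is the coordinate expression `L(z, η)` of the squared metric. -/

section Connection

variable {n : ℕ} (L : CSpace n × CSpace n → ℝ)

/-- The fundamental tensor `g_{i j̄} = ∂²L / ∂η^i ∂η̄^j`. -/
def g (i j : Fin n) : CSpace n × CSpace n → ℂ :=
  dEta i (dEtaBar j (fun q => (L q : ℂ)))

/-- The matrix `(g_{i j̄})`, with row index `i` and column index `j`. -/
def gMatrix (p : CSpace n × CSpace n) : Matrix (Fin n) (Fin n) ℂ :=
  Matrix.of fun i j => g L i j p

/-- The inverse tensor `g^{m̄ k}`, determined by `∑_m g_{l m̄} g^{m̄ k} = δ_l^k`. -/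
def gInv (m k : Fin n) (p : CSpace n × CSpace n) : ℂ :=
  (gMatrix L p)⁻¹ m k

/-- The Chern-Finsler nonlinear connection `N_j^k = g^{m̄ k} (∂g_{l m̄}/∂z^j) η^l`. -/
def nonlin (k j : Fin n) (p : CSpace n × CSpace n) : ℂ :=
  ∑ m, ∑ l, gInv L m k p * dz j (g L l m) p * p.2 l

/-- The horizontal derivative `δ_k f = ∂f/∂z^k - N_k^j ∂f/∂η^j`. -/
def delta (k : Fin n) (f : CSpace n × CSpace n → ℂ) (p : CSpace n × CSpace n) : ℂ :=
  dz k f p - ∑ j, nonlin L j k p * dEta j f p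

/-- The conjugate horizontal derivative `δ_k̄ f = ∂f/∂z̄^k - conj(N_k^j) ∂f/∂η̄^j`. -/
def deltaBar (k : Fin n) (f : CSpace n × CSpace n → ℂ) (p : CSpace n × CSpace n) : ℂ :=
  dzBar k f p - ∑ j, (starRingEnd ℂ) (nonlin L j k p) * dEtaBar j f p

/-- The horizontal connection coefficients `L^i_{jk} = g^{l̄ i} δ_k g_{j l̄}`. -/
def horCoeff (i j k : Fin n) (p : CSpace n × CSpace n) : ℂ :=
  ∑ l, gInv L l i p * delta L k (g L j l) p

/-- The vertical connection coefficients `C^i_{jk} = g^{l̄ i} ∂g_{j l̄}/∂η^k`. -/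
def verCoeff (i j k : Fin n) (p : CSpace n × CSpace n) : ℂ :=
  ∑ l, gInv L l i p * dEta k (g L j l) p

/-- The horizontal torsion `T^i_{jk} = L^i_{jk} - L^i_{kj}`. -/
def torsion (i j k : Fin n) (p : CSpace n × CSpace n) : ℂ :=
  horCoeff L i j k p - horCoeff L i k j p

/-- The horizontal curvature `R^i_{j h̄ k} = -δ_h̄ L^i_{jk} - δ_h̄(N_k^l) C^i_{jl}`. -/
def curvUp (i j h k : Fin n) (p : CSpace n × CSpace n) : ℂ :=
  - deltaBar L h (horCoeff L i j k) p
    - ∑ l, deltaBar L h (nonlin L l k) p * verCoeff L i j l p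

/-- The horizontal Riemann type tensor `R_{r̄ j h̄ k} = g_{l r̄} R^l_{j h̄ k}`. -/
def curv (r j h k : Fin n) (p : CSpace n × CSpace n) : ℂ :=
  ∑ l, g L l r p * curvUp L l j h k p

end Connection

/-! ## Complex Finsler spaces -/

section Manifold

variable {n : ℕ} {M : Type*} [TopologicalSpace M] [ChartedSpace (CSpace n) M]
  [IsManifold 𝓘(ℂ, CSpace n) ω M]

/-- The tangent vector with coordinates `(z, η)` in the chart `φ`: the vector `η^k ∂/∂z^k` at
`φ⁻¹(z)`, that is, the image of `η` under the differential of `φ⁻¹` at `z`. -/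
def tangentPoint (φ : OpenPartialHomeomorph M (CSpace n)) (p : CSpace n × CSpace n) :
    TangentBundle 𝓘(ℂ, CSpace n) M :=
  ⟨φ.symm p.1, mfderiv 𝓘(ℂ, CSpace n) 𝓘(ℂ, CSpace n) φ.symm p.1 p.2⟩

/-- The coordinate expression `L(z, η) = F(z, η)²` of the squared metric in the chart `φ`. -/
def localL (F : TangentBundle 𝓘(ℂ, CSpace n) M → ℝ)
    (φ : OpenPartialHomeomorph M (CSpace n)) (p : CSpace n × CSpace n) : ℝ :=
  F (tangentPoint φ p) ^ 2

/-- The coordinate domain of the slit tangent bundle `T'M \ {0}` over the chart `φ`. -/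
def slitDomain (φ : OpenPartialHomeomorph M (CSpace n)) : Set (CSpace n × CSpace n) :=
  {p | p.1 ∈ φ.target ∧ p.2 ≠ 0}

/-- `F : T'M → ℝ` makes the complex manifold `M` a complex Finsler space. Smoothness (in the real
sense) of `F²` off the zero section and positivity of `(g_{i j̄})` are expressed in the charts. -/
structure IsComplexFinsler (F : TangentBundle 𝓘(ℂ, CSpace n) M → ℝ) : Prop where
  continuous : Continuous F
  smooth : ∀ φ ∈ atlas (CSpace n) M, ContDiffOn ℝ ∞ (localL F φ) (slitDomain φ)
  nonneg : ∀ v, 0 ≤ F v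
  eq_zero_iff : ∀ v, F v = 0 ↔ v.2 = 0
  homogeneous : ∀ (x : M) (c : ℂ) (v : TangentSpace 𝓘(ℂ, CSpace n) x),
    F ⟨x, c • v⟩ = ‖c‖ * F ⟨x, v⟩
  posDef : ∀ φ ∈ atlas (CSpace n) M, ∀ p ∈ slitDomain φ, (gMatrix (localL F φ) p).PosDef

/-- The complex Finsler space is Kähler: `T^i_{jk} η^j = 0` off the zero section. -/
def IsKahler (F : TangentBundle 𝓘(ℂ, CSpace n) M → ℝ) : Prop :=
  ∀ φ ∈ atlas (CSpace n) M, ∀ p ∈ slitDomain φ, ∀ i k : Fin n,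
    ∑ j, torsion (localL F φ) i j k p * p.2 j = 0

/-- The curvature identity `R_{r̄ j h̄ k} = 𝒦 (g_{j r̄} g_{k h̄} + g_{k r̄} g_{j h̄})` off the zero
section, for a real function `𝒦` on `T'M`. -/
def HasCurvatureFactor (F 𝒦 : TangentBundle 𝓘(ℂ, CSpace n) M → ℝ) : Prop :=
  ∀ φ ∈ atlas (CSpace n) M, ∀ p ∈ slitDomain φ, ∀ r j h k : Fin n,
    curv (localL F φ) r j h k p =
      (𝒦 (tangentPoint φ p) : ℂ) *
        (g (localL F φ) j r p * g (localL F φ) k h p +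
          g (localL F φ) k r p * g (localL F φ) j h p)

end Manifold

end

end CFinsler

/-! Write L_j, L_j̄ for the η- and η̄-derivatives of L. The point is that the curvature identity
forces the metric to be Hermitian wherever 𝒦 does not vanish; what remains is a Schur-type argument
on the base. Contracting the identity with η^j gives δ_h̄ N^i_k = -𝒦(η^i g_{kh̄} + δ^i_k L_h̄).
Since H^i_{jk} = ∂N^i_k/∂η^j (`e_N`), δ_h̄ H can be computed from this formula or from the curvature
itself. Comparing the two after contraction with L_i, and then contracting with η̄^h, gives 𝒦 L_{jk}
+ (∂𝒦/∂η^j) L_k = 0 (`HasFactor.mul_e_e`). Contraction with η^k and homogeneity make 𝒦 independent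
of η (`HasFactor.e_factor`); hence L_{jk} = 0 and g depends on z alone where 𝒦 ≠ 0
(`HasFactor.e_g`). There the trace of H has z̄-derivative -(n+1) 𝒦 g_{kh̄}, and commuting two such
derivatives expresses 𝒦 T through the gradient of 𝒦 (`HasFactor.mul_sum_T_mul_g`). A nonzero
constant 𝒦 therefore gives T = 0. Conversely, T^i_{jk} η^j = 0 forces the gradient to vanish in
dimension at least two (`HasFactor.z_mul_y`). So 𝒦 descends to a continuous function on M that is
locally constant where nonzero, and connectedness finishes the proof. The tensor calculus takes
place in an abstract algebra with commuting derivations, realised by smooth functions on open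
subsets of the slit tangent bundle in a chart. -/

namespace CFinsler

/-! ### Formal complex Finsler calculus -/

/-- The algebraic structure carried by the smooth functions on an open set of the slit tangent
bundle: the four families of coordinate derivations, conjugation, the fibre coordinates `y`, the
squared metric `L` and the inverse `gi` of its fundamental tensor. -/
structure FinslerAlgebra (n : ℕ) (A : Type*) [CommRing A] [Algebra ℂ A] where
  /-- `∂/∂z^k` -/
  z : Fin n → Derivation ℂ A A
  /-- `∂/∂z̄^k` -/
  zb : Fin n → Derivation ℂ A A
  /-- `∂/∂η^k` -/
  e : Fin n → Derivation ℂ A A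
  /-- `∂/∂η̄^k` -/
  eb : Fin n → Derivation ℂ A A
  /-- complex conjugation -/
  conj : A →+* A
  /-- the fibre coordinates -/
  y : Fin n → A
  /-- the squared metric -/
  L : A
  /-- the inverse fundamental tensor -/
  gi : Fin n → Fin n → A
  e_e : ∀ i j f, e i (e j f) = e j (e i f)
  eb_e : ∀ i j f, eb i (e j f) = e j (eb i f)
  z_e : ∀ i j f, z i (e j f) = e j (z i f)
  z_eb : ∀ i j f, z i (eb j f) = eb j (z i f)
  zb_e : ∀ i j f, zb i (e j f) = e j (zb i f)
  zb_zb : ∀ i j f, zb i (zb j f) = zb j (zb i f)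
  conj_e : ∀ i f, conj (e i f) = eb i (conj f)
  conj_eb : ∀ i f, conj (eb i f) = e i (conj f)
  conj_zb : ∀ i f, conj (zb i f) = z i (conj f)
  conj_L : conj L = L
  e_y : ∀ i j, e i (y j) = if i = j then 1 else 0
  z_y : ∀ i j, z i (y j) = 0
  zb_y : ∀ i j, zb i (y j) = 0
  eb_y : ∀ i j, eb i (y j) = 0
  isUnit_L : IsUnit L
  euler : ∑ k, y k * e k L = L
  g_gi : ∀ l k, ∑ m, e l (eb m L) * gi m k = if l = k then 1 else 0
  gi_g : ∀ m r, ∑ k, gi m k * e k (eb r L) = if m = r then 1 else 0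

namespace FinslerAlgebra

variable {n : ℕ} {A : Type*} [CommRing A] [Algebra ℂ A] (S : FinslerAlgebra n A)

/-- The conjugate fibre coordinates. -/
def yb (k : Fin n) : A := S.conj (S.y k)

/-- The fundamental tensor. -/
def g (i j : Fin n) : A := S.e i (S.eb j S.L)

/-- The Chern-Finsler nonlinear connection. -/
def N (k j : Fin n) : A := ∑ m, ∑ l, S.gi m k * S.z j (S.g l m) * S.y l

/-- The horizontal derivation. -/
def delta (k : Fin n) : Derivation ℂ A A := S.z k - ∑ j, S.N j k • S.e j

/-- The conjugate horizontal derivation. -/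
def deltaBar (k : Fin n) : Derivation ℂ A A := S.zb k - ∑ j, S.conj (S.N j k) • S.eb j

/-- The horizontal connection coefficients. -/
def H (i j k : Fin n) : A := ∑ l, S.gi l i * S.delta k (S.g j l)

/-- The vertical connection coefficients. -/
def C (i j k : Fin n) : A := ∑ l, S.gi l i * S.e k (S.g j l)

/-- The horizontal torsion. -/
def T (i j k : Fin n) : A := S.H i j k - S.H i k j

/-- The horizontal curvature. -/
def Rup (i j h k : Fin n) : A :=
  -S.deltaBar h (S.H i j k) - ∑ l, S.deltaBar h (S.N l k) * S.C i j l

/-- The horizontal curvature with lowered index. -/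
def R (r j h k : Fin n) : A := ∑ l, S.g l r * S.Rup l j h k

lemma derivation_sum_apply {ι : Type*} (s : Finset ι) (D : ι → Derivation ℂ A A) (f : A) :
    (∑ i ∈ s, D i) f = ∑ i ∈ s, D i f := by
  classical
  induction s using Finset.induction_on with
  | empty => simp
  | insert a s ha ih => simp [Finset.sum_insert ha, ih]

lemma delta_apply (k : Fin n) (f : A) : S.delta k f = S.z k f - ∑ j, S.N j k * S.e j f := by
  simp [delta, derivation_sum_apply]

lemma deltaBar_apply (k : Fin n) (f : A) :
    S.deltaBar k f = S.zb k f - ∑ j, S.conj (S.N j k) * S.eb j f := by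
  simp [deltaBar, derivation_sum_apply]

lemma sum_gi_mul_g (m r : Fin n) : ∑ k, S.gi m k * S.g k r = if m = r then 1 else 0 := S.gi_g m r

lemma sum_g_mul_gi (l k : Fin n) : ∑ m, S.g l m * S.gi m k = if l = k then 1 else 0 := S.g_gi l k

lemma conj_g (i j : Fin n) : S.conj (S.g i j) = S.g j i := by
  simp only [g, S.conj_e, S.conj_eb, S.conj_L, S.eb_e]

lemma sum_lower (X : Fin n → A) (r : Fin n) :
    ∑ i, (∑ l, S.gi l i * X l) * S.g i r = X r := by
  simp only [Finset.sum_mul]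
  rw [Finset.sum_comm]
  have : ∀ l, ∑ i, S.gi l i * X l * S.g i r = X l * if l = r then 1 else 0 := fun l => by
    rw [← S.sum_gi_mul_g, Finset.mul_sum]
    exact Finset.sum_congr rfl fun _ _ => by ring
  simp [this]

/-- Nondegeneracy of g, by multiplying with `gi`. Most identities for upper indices below are
checked after lowering, where no inverse matrix appears. -/
lemma eq_of_lower {X Y : Fin n → A}
    (h : ∀ r, ∑ i, X i * S.g i r = ∑ i, Y i * S.g i r) (i : Fin n) : X i = Y i := by
  have key : ∀ Z : Fin n → A, ∑ r, (∑ i, Z i * S.g i r) * S.gi r i = Z i := fun Z => by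
    simp only [Finset.sum_mul]
    rw [Finset.sum_comm]
    have : ∀ l, ∑ r, Z l * S.g l r * S.gi r i = Z l * if l = i then 1 else 0 := fun l => by
      rw [← S.sum_g_mul_gi, Finset.mul_sum]
      exact Finset.sum_congr rfl fun _ _ => by ring
    simp [this]
  rw [← key X, ← key Y]
  simp [h]

lemma euler_bar : ∑ k, S.yb k * S.eb k S.L = S.L := by
  have := congrArg S.conj S.euler
  simpa [S.conj_e, S.conj_L, yb] using this

lemma sum_y_mul_g (h : Fin n) : ∑ k, S.y k * S.g k h = S.eb h S.L := by
  have := congrArg (S.eb h) S.euler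
  simpa [S.eb_y, S.eb_e, g] using this

lemma sum_yb_mul_g (j : Fin n) : ∑ h, S.yb h * S.g j h = S.e j S.L := by
  have := congrArg S.conj (S.sum_y_mul_g j)
  simpa [S.conj_g, S.conj_eb, S.conj_L, yb] using this

lemma e_g_comm (j k h : Fin n) : S.e k (S.g j h) = S.e j (S.g k h) := S.e_e _ _ _

lemma e_yb (i j : Fin n) : S.e i (S.yb j) = 0 := by
  rw [yb, ← S.conj_eb, S.eb_y, map_zero]

lemma sum_y_mul_e_g (k h : Fin n) : ∑ j, S.y j * S.e k (S.g j h) = 0 := by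
  have := congrArg (S.e k) (S.sum_y_mul_g h)
  simpa [S.e_y, Finset.sum_add_distrib, g] using this

lemma sum_y_mul_e_e (j : Fin n) : ∑ k, S.y k * S.e j (S.e k S.L) = 0 := by
  have := congrArg (S.e j) S.euler
  simpa [S.e_y, Finset.sum_add_distrib] using this

lemma sum_yb_mul_e_g (j k : Fin n) : ∑ h, S.yb h * S.e k (S.g j h) = S.e k (S.e j S.L) := by
  have := congrArg (S.e k) (S.sum_yb_mul_g j)
  simpa [S.e_yb] using this

lemma sum_N_mul_g (j r : Fin n) : ∑ k, S.N k j * S.g k r = S.z j (S.eb r S.L) := by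
  have h1 : ∀ k, S.N k j = ∑ m, S.gi m k * ∑ l, S.z j (S.g l m) * S.y l := fun k => by
    simp only [N, Finset.mul_sum, mul_assoc]
  simp only [h1]
  rw [S.sum_lower (fun m => ∑ l, S.z j (S.g l m) * S.y l), ← S.sum_y_mul_g]
  simp [S.z_y, mul_comm]

/-- By homogeneity L_i = η̄^r g_{ir̄}, so pairing with ∂L/∂η is lowering the index and then
contracting with η̄. -/
lemma sum_contract (X : Fin n → A) :
    ∑ i, X i * S.e i S.L = ∑ r, S.yb r * ∑ i, X i * S.g i r := by
  simp only [← S.sum_yb_mul_g, Finset.mul_sum]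
  rw [Finset.sum_comm]
  exact Finset.sum_congr rfl fun _ _ => Finset.sum_congr rfl fun _ _ => by ring

lemma z_yb (i j : Fin n) : S.z i (S.yb j) = 0 := by
  rw [yb, ← S.conj_zb, S.zb_y, map_zero]

lemma sum_N_mul_e (j : Fin n) : ∑ k, S.N k j * S.e k S.L = S.z j S.L := by
  rw [S.sum_contract]
  simp only [S.sum_N_mul_g]
  conv_rhs => rw [← S.euler_bar]
  simp [S.z_yb]

/-- The derivatives `∂N/∂η̄` are annihilated by `∂L/∂η`. -/
lemma sum_eb_N_mul_e (j l : Fin n) : ∑ k, S.eb l (S.N k j) * S.e k S.L = 0 := by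
  have := congrArg (S.eb l) (S.sum_N_mul_e j)
  -- In the η̄^l-derivative of N^k_j L_k = ∂L/∂z^j, the terms where L_k is differentiated already
  -- equal the right-hand side, so the others sum to zero.
  have h2 : ∑ k, S.N k j * S.eb l (S.e k S.L) = S.eb l (S.z j S.L) := by
    simp only [S.eb_e, ← S.z_eb, ← S.sum_N_mul_g, g]
  simp only [map_sum, Derivation.leibniz, smul_eq_mul, Finset.sum_add_distrib, h2] at this
  simpa [mul_comm] using this

lemma sum_H_mul_g (j k r : Fin n) : ∑ i, S.H i j k * S.g i r = S.delta k (S.g j r) :=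
  S.sum_lower (fun l => S.delta k (S.g j l)) r

lemma sum_C_mul_g (j k r : Fin n) : ∑ i, S.C i j k * S.g i r = S.e k (S.g j r) :=
  S.sum_lower (fun l => S.e k (S.g j l)) r

/-- The horizontal coefficients are the vertical derivatives of the nonlinear connection. -/
lemma e_N (i j k : Fin n) : S.e j (S.N i k) = S.H i j k := by
  refine S.eq_of_lower (X := fun i => S.e j (S.N i k)) (Y := fun i => S.H i j k) (fun r => ?_) i
  -- Differentiating N^l_k g_{lr̄} = ∂L_r̄/∂z^k in η^j: by symmetry of ∂g/∂η, the terms in the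
  -- derivative of g are the vertical correction inside δ_k g_{jr̄}.
  have := congrArg (S.e j) (S.sum_N_mul_g k r)
  simp only [map_sum, Derivation.leibniz, smul_eq_mul, Finset.sum_add_distrib, ← S.z_e] at this
  rw [S.sum_H_mul_g, delta_apply, g, ← this]
  have h2 : ∀ l, S.N l k * S.e l (S.e j (S.eb r S.L)) = S.N l k * S.e j (S.g l r) := fun l => by
    rw [S.e_e, g]
  simp [h2, mul_comm]

/-- The vertical part of δ_k drops out because η^j ∂g_{jr̄}/∂η^l = 0; the z-part is the derivative
of η^j g_{jr̄} = L_r̄. -/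
lemma sum_y_mul_H (i k : Fin n) : ∑ j, S.y j * S.H i j k = S.N i k := by
  refine S.eq_of_lower (X := fun i => ∑ j, S.y j * S.H i j k) (Y := fun i => S.N i k)
    (fun r => ?_) i
  rw [S.sum_N_mul_g]
  simp only [Finset.sum_mul]
  rw [Finset.sum_comm]
  simp only [mul_assoc, ← Finset.mul_sum, S.sum_H_mul_g, delta_apply, mul_sub,
    Finset.sum_sub_distrib]
  have h1 : ∑ j, S.y j * ∑ l, S.N l k * S.e l (S.g j r) = 0 := by
    simp only [Finset.mul_sum]
    rw [Finset.sum_comm]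
    refine Finset.sum_eq_zero fun l _ => ?_
    rw [← mul_zero (S.N l k), ← S.sum_y_mul_e_g l r, Finset.mul_sum]
    exact Finset.sum_congr rfl fun _ _ => by ring
  rw [h1, ← S.sum_y_mul_g]
  simp [S.z_y]

lemma sum_y_mul_C (i l : Fin n) : ∑ j, S.y j * S.C i j l = 0 := by
  refine S.eq_of_lower (X := fun i => ∑ j, S.y j * S.C i j l) (Y := fun _ => 0) (fun r => ?_) i
  simp only [Finset.sum_mul]
  rw [Finset.sum_comm]
  simp only [mul_assoc, ← Finset.mul_sum, S.sum_C_mul_g]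
  simp [S.sum_y_mul_e_g]

lemma C_comm (i j k : Fin n) : S.C i j k = S.C i k j := by
  simp only [C, S.e_g_comm j k]

lemma sum_C_mul_e (j k : Fin n) : ∑ i, S.C i j k * S.e i S.L = S.e k (S.e j S.L) := by
  rw [S.sum_contract]
  simp only [S.sum_C_mul_g, S.sum_yb_mul_e_g]

/-- The commutator of `δ_h̄` and `∂/∂η^j`. -/
lemma deltaBar_e (h j : Fin n) (f : A) : S.deltaBar h (S.e j f) =
    S.e j (S.deltaBar h f) + ∑ l, S.e j (S.conj (S.N l h)) * S.eb l f := by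
  simp only [deltaBar_apply, map_sub, map_sum, Derivation.leibniz, smul_eq_mul, S.zb_e, S.eb_e,
    Finset.sum_add_distrib]
  simp only [mul_comm (S.e j (S.conj _))]
  ring

lemma deltaBar_y (h j : Fin n) : S.deltaBar h (S.y j) = 0 := by
  simp [deltaBar_apply, S.zb_y, S.eb_y]

/-! ### Consequences of the curvature identity -/

variable {S} {K : A}

/-- The curvature identity with factor `K`. -/
def HasFactor (S : FinslerAlgebra n A) (K : A) : Prop :=
  ∀ r j h k, S.R r j h k = K * (S.g j r * S.g k h + S.g k r * S.g j h)

lemma HasFactor.Rup_eq (hR : S.HasFactor K) (i j h k : Fin n) : S.Rup i j h k =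
    K * ((if j = i then 1 else 0) * S.g k h + (if k = i then 1 else 0) * S.g j h) := by
  refine S.eq_of_lower (X := fun i => S.Rup i j h k) (Y := fun i =>
    K * ((if j = i then 1 else 0) * S.g k h + (if k = i then 1 else 0) * S.g j h)) (fun r => ?_) i
  have := hR r j h k
  rw [R] at this
  simp only [mul_comm (S.Rup _ _ _ _), this, mul_add, add_mul, Finset.sum_add_distrib]
  simp
  ring

/-- Contraction of the curvature with η^j: the C-term vanishes, H becomes N, and δ_h̄ passes through
η^j. -/
lemma HasFactor.deltaBar_N (hR : S.HasFactor K) (i h k : Fin n) : S.deltaBar h (S.N i k) =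
    -K * (S.y i * S.g k h + (if k = i then 1 else 0) * S.eb h S.L) := by
  have h1 : ∑ j, S.y j * S.Rup i j h k = -S.deltaBar h (S.N i k) := by
    have h2 : ∑ j, S.y j * ∑ l, S.deltaBar h (S.N l k) * S.C i j l = 0 := by
      simp only [Finset.mul_sum]
      rw [Finset.sum_comm]
      refine Finset.sum_eq_zero fun l _ => ?_
      rw [← mul_zero (S.deltaBar h (S.N l k)), ← S.sum_y_mul_C i l, Finset.mul_sum]
      exact Finset.sum_congr rfl fun _ _ => by ring
    simp only [Rup, mul_sub, Finset.sum_sub_distrib, h2]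
    rw [← S.sum_y_mul_H]
    simp [S.deltaBar_y]
  rw [← neg_neg (S.deltaBar h (S.N i k)), ← h1]
  have h3 : ∀ j, S.y j * S.Rup i j h k = K * ((if j = i then S.y j else 0) * S.g k h +
      (if k = i then 1 else 0) * (S.y j * S.g j h)) := fun j => by
    rw [hR.Rup_eq]
    split_ifs <;> ring
  simp only [h3, ← Finset.mul_sum, Finset.sum_add_distrib, ← Finset.sum_mul, S.sum_y_mul_g]
  simp

/-- Solve the definition of the curvature for δ_h̄ H and insert `deltaBar_N`; the part of δ_h̄ N
along η is annihilated by C, which is symmetric in its lower indices. -/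
lemma HasFactor.deltaBar_H (hR : S.HasFactor K) (i j h k : Fin n) : S.deltaBar h (S.H i j k) =
    -K * ((if j = i then 1 else 0) * S.g k h + (if k = i then 1 else 0) * S.g j h) +
      K * S.eb h S.L * S.C i j k := by
  have h1 : S.deltaBar h (S.H i j k) =
      -S.Rup i j h k - ∑ l, S.deltaBar h (S.N l k) * S.C i j l := by
    rw [Rup]; ring
  have h2 : ∑ l, S.deltaBar h (S.N l k) * S.C i j l = -K * (S.eb h S.L * S.C i j k) := by
    have h3 : ∀ l, S.deltaBar h (S.N l k) * S.C i j l = -K * (S.g k h * (S.y l * S.C i l j) +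
        S.eb h S.L * (if k = l then S.C i j l else 0)) := fun l => by
      rw [hR.deltaBar_N, S.C_comm i l j]
      split_ifs <;> ring
    simp only [h3, ← Finset.mul_sum, Finset.sum_add_distrib, S.sum_y_mul_C]
    simp
  rw [h1, h2, hR.Rup_eq]
  ring

/-- Two evaluations of (δ_h̄ H^i_{jk}) L_i: from `deltaBar_H`, and from H = ∂N/∂η by commuting δ_h̄
with ∂/∂η^j. The commutator involves only ∂N/∂η̄, which the contraction with L_i kills. -/
lemma HasFactor.vertical_aux (hR : S.HasFactor K) (j k h : Fin n) :
    K * S.eb h S.L * S.e k (S.e j S.L) + S.e j K * (S.L * S.g k h + S.e k S.L * S.eb h S.L) +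
      K * S.L * S.e j (S.g k h) = 0 := by
  have h1 : ∑ i, S.deltaBar h (S.H i j k) * S.e i S.L =
      -K * (S.e j S.L * S.g k h + S.e k S.L * S.g j h) +
        K * S.eb h S.L * S.e k (S.e j S.L) := by
    have : ∀ i, S.deltaBar h (S.H i j k) * S.e i S.L =
        -K * ((if j = i then S.e i S.L else 0) * S.g k h +
          (if k = i then S.e i S.L else 0) * S.g j h) +
        K * S.eb h S.L * (S.C i j k * S.e i S.L) := fun i => by
      rw [hR.deltaBar_H]
      split_ifs <;> ring
    simp only [this, Finset.sum_add_distrib, ← Finset.mul_sum, ← Finset.sum_mul, S.sum_C_mul_e]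
    simp
  have h2 : ∑ i, S.deltaBar h (S.H i j k) * S.e i S.L =
      -S.e j K * (S.L * S.g k h + S.e k S.L * S.eb h S.L) -
      K * (S.e j S.L * S.g k h + S.L * S.e j (S.g k h) + S.e k S.L * S.g j h) := by
    have h3 : ∑ i, (∑ l, S.e j (S.conj (S.N l h)) * S.eb l (S.N i k)) * S.e i S.L = 0 := by
      simp only [Finset.sum_mul]
      rw [Finset.sum_comm]
      simp only [mul_assoc, ← Finset.mul_sum, S.sum_eb_N_mul_e, mul_zero, Finset.sum_const_zero]
    have h4 : ∀ i, S.e j (S.deltaBar h (S.N i k)) * S.e i S.L =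
        -S.e j K * (S.g k h * (S.y i * S.e i S.L) + (if k = i then S.e i S.L else 0) * S.eb h S.L)
        - K * ((if j = i then S.e i S.L else 0) * S.g k h + S.e j (S.g k h) * (S.y i * S.e i S.L)
          + (if k = i then S.e i S.L else 0) * S.g j h) := fun i => by
      rw [hR.deltaBar_N]
      simp only [Derivation.leibniz, map_neg, map_add, smul_eq_mul, S.e_y, g]
      split_ifs <;> simp <;> ring
    simp only [← S.e_N, S.deltaBar_e, add_mul, Finset.sum_add_distrib]
    rw [h3]
    simp only [h4, Finset.sum_sub_distrib, ← Finset.mul_sum, Finset.sum_add_distrib,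
      ← Finset.sum_mul, S.euler]
    simp
    ring
  linear_combination h1.symm.trans h2

/-- Contracting `vertical_aux` with η̄^h turns it into 2L times the stated expression, and both 2
and L are units. -/
lemma HasFactor.mul_e_e (hR : S.HasFactor K) (j k : Fin n) :
    K * S.e k (S.e j S.L) + S.e j K * S.e k S.L = 0 := by
  have h1 : ∀ h, S.yb h * (K * S.eb h S.L * S.e k (S.e j S.L) +
      S.e j K * (S.L * S.g k h + S.e k S.L * S.eb h S.L) + K * S.L * S.e j (S.g k h)) =
      K * S.e k (S.e j S.L) * (S.yb h * S.eb h S.L) + S.e j K * S.L * (S.yb h * S.g k h) +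
      S.e j K * S.e k S.L * (S.yb h * S.eb h S.L) + K * S.L * (S.yb h * S.e j (S.g k h)) :=
    fun h => by ring
  have h2 : ∑ h, S.yb h * (K * S.eb h S.L * S.e k (S.e j S.L) +
      S.e j K * (S.L * S.g k h + S.e k S.L * S.eb h S.L) + K * S.L * S.e j (S.g k h)) = 0 := by
    simp [hR.vertical_aux]
  simp only [h1, Finset.sum_add_distrib, ← Finset.mul_sum, S.euler_bar, S.sum_yb_mul_g,
    S.sum_yb_mul_e_g, S.e_e j k] at h2
  have h3 : (2 : A) * (S.L * (K * S.e k (S.e j S.L) + S.e j K * S.e k S.L)) = 0 := by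
    linear_combination h2
  have h4 : IsUnit (2 : A) := by
    simpa only [map_ofNat] using (IsUnit.mk0 (2 : ℂ) two_ne_zero).map (algebraMap ℂ A)
  rwa [h4.mul_right_eq_zero, S.isUnit_L.mul_right_eq_zero] at h3

/-- The curvature factor does not depend on the fibre coordinates. -/
lemma HasFactor.e_factor (hR : S.HasFactor K) (j : Fin n) : S.e j K = 0 := by
  -- Contraction with η^k removes L_{jk}, because L_j has degree zero in η, and leaves L ∂K/∂η^j =
  -- 0.
  have h1 : ∑ k, S.y k * (K * S.e k (S.e j S.L) + S.e j K * S.e k S.L) = 0 := by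
    simp [hR.mul_e_e]
  have h2 : ∀ k, S.y k * (K * S.e k (S.e j S.L) + S.e j K * S.e k S.L) =
    K * (S.y k * S.e j (S.e k S.L)) + S.e j K * (S.y k * S.e k S.L) := fun k => by
      rw [S.e_e j k]; ring
  simp only [h2, Finset.sum_add_distrib, ← Finset.mul_sum, S.sum_y_mul_e_e, S.euler, mul_zero,
    zero_add] at h1
  rwa [S.isUnit_L.mul_left_eq_zero] at h1

/-- Where the factor does not vanish, the metric is purely Hermitian. -/
lemma HasFactor.e_g (hR : S.HasFactor K) (hK : IsUnit K) (j k h : Fin n) :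
    S.e k (S.g j h) = 0 := by
  -- With ∂K/∂η = 0 this reads K L_{jk} = 0, and ∂g_{jh̄}/∂η^k is the η̄^h-derivative of L_{jk}.
  have h1 := hR.mul_e_e j k
  rw [hR.e_factor, zero_mul, add_zero, hK.mul_right_eq_zero] at h1
  rw [g, ← S.eb_e, ← S.eb_e, h1, map_zero]

lemma HasFactor.eb_g (hR : S.HasFactor K) (hK : IsUnit K) (j k h : Fin n) :
    S.eb k (S.g j h) = 0 := by
  rw [← S.conj_g, ← S.conj_e, hR.e_g hK, map_zero]

lemma HasFactor.sum_H_mul_g (hR : S.HasFactor K) (hK : IsUnit K) (j k r : Fin n) :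
    ∑ i, S.H i j k * S.g i r = S.z k (S.g j r) := by
  rw [S.sum_H_mul_g, delta_apply]
  simp [hR.e_g hK]

lemma HasFactor.eb_H (hR : S.HasFactor K) (hK : IsUnit K) (i j k l : Fin n) :
    S.eb l (S.H i j k) = 0 := by
  refine S.eq_of_lower (X := fun i => S.eb l (S.H i j k)) (Y := fun _ => 0) (fun r => ?_) i
  have h1 := congrArg (S.eb l) (hR.sum_H_mul_g hK j k r)
  have h2 : S.eb l (S.z k (S.g j r)) = 0 := by
    rw [← S.z_eb, hR.eb_g hK, map_zero]
  simpa [Derivation.leibniz, hR.eb_g hK, h2, mul_comm] using h1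

/-- Without fibre dependence, C vanishes and δ_h̄ acts on H as ∂/∂z̄^h. -/
lemma HasFactor.zb_H (hR : S.HasFactor K) (hK : IsUnit K) (i j h k : Fin n) :
    S.zb h (S.H i j k) =
      -K * ((if j = i then 1 else 0) * S.g k h + (if k = i then 1 else 0) * S.g j h) := by
  have h1 := hR.deltaBar_H i j h k
  have h2 : S.C i j k = 0 := by simp [C, hR.e_g hK]
  rw [deltaBar_apply] at h1
  simpa [hR.eb_H hK, h2] using h1

/-- The contracted second Bianchi identity. -/
lemma HasFactor.zb_mul_g (hR : S.HasFactor K) (hK : IsUnit K) (h k l : Fin n) :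
    S.zb l (K * S.g k h) = S.zb h (K * S.g k l) := by
  -- In the trace over i = j, the first Kronecker delta contributes n and the second contributes 1.
  have h1 : ∀ h, S.zb h (∑ i, S.H i i k) = ((-(n + 1) : ℂ)) • (K * S.g k h) := fun h => by
    simp only [map_sum, hR.zb_H hK, ← Finset.mul_sum, Finset.sum_add_distrib]
    simp [Algebra.smul_def]
    ring
  have h2 := S.zb_zb l h (∑ i, S.H i i k)
  rw [h1, h1, Derivation.map_smul, Derivation.map_smul] at h2
  have h3 : (-(n + 1) : ℂ) ≠ 0 := neg_ne_zero.mpr (by exact_mod_cast n.succ_ne_zero)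
  have h4 := congrArg (fun f => (-(n + 1) : ℂ)⁻¹ • f) h2
  simpa only [inv_smul_smul₀ h3] using h4

/-- The torsion in terms of the gradient of the factor. -/
lemma HasFactor.mul_sum_T_mul_g (hR : S.HasFactor K) (hK : IsUnit K) (hKr : S.conj K = K)
    (h k l : Fin n) :
    K * ∑ i, S.T i h l * S.g i k = S.z h K * S.g l k - S.z l K * S.g h k := by
  -- Conjugation gives the same identity for z-derivatives, as K is real. Its terms in ∂g/∂z are K
  -- times lowered coefficients H, and their difference is the torsion.
  have h1 := congrArg S.conj (hR.zb_mul_g hK h k l)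
  simp only [Derivation.leibniz, smul_eq_mul, map_add, map_mul, S.conj_zb, hKr, S.conj_g] at h1
  simp only [T, sub_mul, Finset.sum_sub_distrib, hR.sum_H_mul_g hK]
  linear_combination h1

/-- If the factor is constant then the torsion vanishes. -/
lemma HasFactor.T_eq_zero (hR : S.HasFactor K) (hK : IsUnit K) (hKr : S.conj K = K)
    (hz : ∀ k, S.z k K = 0) (i h l : Fin n) : S.T i h l = 0 := by
  refine S.eq_of_lower (X := fun i => S.T i h l) (Y := fun _ => 0) (fun r => ?_) i
  have := hR.mul_sum_T_mul_g hK hKr h r l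
  simp only [hz, zero_mul, sub_zero, hK.mul_right_eq_zero] at this
  simpa using this

/-- If `T^i_{jk} η^j = 0` then the gradient of the factor is trivial in rank at least two. -/
lemma HasFactor.z_mul_y (hR : S.HasFactor K) (hK : IsUnit K) (hKr : S.conj K = K)
    (hT : ∀ i k, ∑ j, S.T i j k * S.y j = 0) (l m : Fin n) :
    S.z l K * S.y m = if l = m then ∑ h, S.z h K * S.y h else 0 := by
  refine S.eq_of_lower (X := fun m => S.z l K * S.y m)
    (Y := fun m => if l = m then ∑ h, S.z h K * S.y h else 0) (fun r => ?_) m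
  -- The torsion formula contracted with η^h; raising the index r in the result gives the claim.
  have h1 : ∑ h, (K * ∑ i, S.T i h l * S.g i r) * S.y h = 0 := by
    have : ∀ h, (K * ∑ i, S.T i h l * S.g i r) * S.y h =
        ∑ i, K * S.g i r * (S.T i h l * S.y h) := fun h => by
      simp only [Finset.mul_sum, Finset.sum_mul]
      exact Finset.sum_congr rfl fun _ _ => by ring
    simp only [this]
    rw [Finset.sum_comm]
    simp only [← Finset.mul_sum, hT, mul_zero, Finset.sum_const_zero]
  simp only [hR.mul_sum_T_mul_g hK hKr, sub_mul, Finset.sum_sub_distrib] at h1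
  have h2 : ∑ h, S.z l K * S.g h r * S.y h = ∑ i, S.z l K * S.y i * S.g i r :=
    Finset.sum_congr rfl fun _ _ => by ring
  rw [← h2, ← sub_eq_zero.mp h1]
  simp only [ite_mul, zero_mul, Finset.sum_ite_eq, Finset.mem_univ, if_true, Finset.sum_mul]
  exact Finset.sum_congr rfl fun _ _ => by ring

end FinslerAlgebra
end CFinsler

/-! ### Smooth functions on an open set as a differential algebra -/

namespace CFinsler

open Topology

noncomputable section

/-- The algebra of complex functions on `U` that are restrictions of functions smooth on `U`. -/
def smoothAlgebra {E : Type*} [NormedAddCommGroup E] [NormedSpace ℝ E] (U : Set E) :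
    Subalgebra ℂ (U → ℂ) where
  carrier := {f | ∃ F : E → ℂ, ContDiffOn ℝ ∞ F U ∧ ∀ x : U, F x = f x}
  mul_mem' := by
    rintro f f' ⟨F, hF, h⟩ ⟨F', hF', h'⟩
    exact ⟨fun x => F x * F' x, hF.mul hF', fun x => by simp [h, h']⟩
  add_mem' := by
    rintro f f' ⟨F, hF, h⟩ ⟨F', hF', h'⟩
    exact ⟨fun x => F x + F' x, hF.add hF', fun x => by simp [h, h']⟩
  algebraMap_mem' c := ⟨fun _ => c, contDiffOn_const, fun _ => rfl⟩

namespace smoothAlgebra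

variable {E : Type*} [NormedAddCommGroup E] [NormedSpace ℝ E] {U : Set E}

/-- A function on the ambient space that represents `f` on `U`. -/
def rep (f : smoothAlgebra U) : E → ℂ := f.2.choose

lemma contDiffOn_rep (f : smoothAlgebra U) : ContDiffOn ℝ ∞ (rep f) U := f.2.choose_spec.1

lemma rep_apply (f : smoothAlgebra U) (x : U) : rep f x = f.1 x := f.2.choose_spec.2 x

/-- The element of the algebra given by a function smooth on `U`. -/
def mk (F : E → ℂ) (hF : ContDiffOn ℝ ∞ F U) : smoothAlgebra U := ⟨fun x => F x, F, hF, fun _ => rfl⟩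

@[simp] lemma mk_apply (F : E → ℂ) (hF : ContDiffOn ℝ ∞ F U) (x : U) : (mk F hF).1 x = F x := rfl

@[ext] lemma ext' {f f' : smoothAlgebra U} (h : ∀ x, f.1 x = f'.1 x) : f = f' :=
  Subtype.ext (funext h)

/-- Evaluation at a point of `U`. -/
def eval (x : U) : smoothAlgebra U →+* ℂ :=
  (Pi.evalRingHom (fun _ => ℂ) x).comp (smoothAlgebra U).subtype

@[simp] lemma eval_apply (x : U) (f : smoothAlgebra U) : eval x f = f.1 x := rfl

lemma ext_eval {f f' : smoothAlgebra U} (h : ∀ x, eval x f = eval x f') : f = f' := ext' h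

lemma eval_algebraMap (x : U) (c : ℂ) : eval x (algebraMap ℂ (smoothAlgebra U) c) = c := rfl

lemma eval_smul (x : U) (c : ℂ) (f : smoothAlgebra U) : eval x (c • f) = c * eval x f := rfl

lemma isUnit_of_ne_zero {f : smoothAlgebra U} (h : ∀ x, eval x f ≠ 0) : IsUnit f := by
  refine .of_mul_eq_one (mk (fun x => (rep f x)⁻¹) ((contDiffOn_rep f).inv fun x hx => ?_)) ?_
  · rw [rep_apply f ⟨x, hx⟩]
    exact h ⟨x, hx⟩
  · refine ext_eval fun x => ?_
    rw [map_mul, map_one, eval_apply x (mk _ _), mk_apply, rep_apply]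
    exact mul_inv_cancel₀ (h x)

/-- As U is open, f determines the germ of any representative at points of U; derivatives are thus
independent of the choice made in `rep`. -/
lemma eventuallyEq_rep (hU : IsOpen U) {f : smoothAlgebra U} {F : E → ℂ}
    (h : ∀ x : U, F x = eval x f) (x : U) : rep f =ᶠ[𝓝 (x : E)] F :=
  Filter.eventuallyEq_of_mem (hU.mem_nhds x.2) fun y hy => by
    rw [rep_apply f ⟨y, hy⟩, h ⟨y, hy⟩, eval_apply]

lemma differentiableAt_rep (hU : IsOpen U) (f : smoothAlgebra U) (x : U) :
    DifferentiableAt ℝ (rep f) x :=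
  ((contDiffOn_rep f).contDiffAt (hU.mem_nhds x.2)).differentiableAt (by simp)

/-- The value of a directional derivative on representatives. -/
def dirFun (v : E) (f : smoothAlgebra U) (hU : IsOpen U) : smoothAlgebra U :=
  mk (fun x => fderiv ℝ (rep f) x v)
    (((contDiffOn_rep f).fderiv_of_isOpen hU (m := ∞) le_rfl).clm_apply contDiffOn_const)

lemma eval_dirFun (hU : IsOpen U) (v : E) {f : smoothAlgebra U} {F : E → ℂ}
    (h : ∀ x : U, F x = eval x f) (x : U) : eval x (dirFun v f hU) = fderiv ℝ F x v := by
  rw [eval_apply, dirFun, mk_apply, (eventuallyEq_rep hU h x).fderiv_eq]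

lemma rep_eval (f : smoothAlgebra U) (x : U) : rep f x = eval x f := rep_apply f x

/-- The directional derivative, as a derivation. -/
def dirDeriv (hU : IsOpen U) (v : E) : Derivation ℂ (smoothAlgebra U) (smoothAlgebra U) :=
  Derivation.mk'
    { toFun := fun f => dirFun v f hU
      map_add' := fun f f' => ext_eval fun x => by
        rw [eval_dirFun hU v (F := fun y => rep f y + rep f' y) (fun y => by simp [rep_apply]),
          fderiv_fun_add (differentiableAt_rep hU f x) (differentiableAt_rep hU f' x)]
        simp [eval_dirFun hU v (rep_eval _), - eval_apply]
      map_smul' := fun c f => ext_eval fun x => by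
        rw [eval_dirFun hU v (F := fun y => c • rep f y) (fun y => by simp [rep_apply]),
          fderiv_fun_const_smul (differentiableAt_rep hU f x)]
        rw [RingHom.id_apply, eval_smul, eval_dirFun hU v (rep_eval _)]
        rfl }
    fun f f' => ext_eval fun x => by
      change eval x (dirFun v (f * f') hU) = eval x (f * dirFun v f' hU + f' * dirFun v f hU)
      rw [eval_dirFun hU v (F := fun y => rep f y * rep f' y) (fun y => by simp [rep_apply]),
          fderiv_fun_mul (differentiableAt_rep hU f x) (differentiableAt_rep hU f' x)]
      simp [eval_dirFun hU v (rep_eval _), rep_eval, - eval_apply]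

lemma eval_dirDeriv (hU : IsOpen U) (v : E) {f : smoothAlgebra U} {F : E → ℂ}
    (h : ∀ x : U, F x = eval x f) (x : U) : eval x (dirDeriv hU v f) = fderiv ℝ F x v :=
  eval_dirFun hU v h x

lemma dirDeriv_comm (hU : IsOpen U) (v w : E) (f : smoothAlgebra U) :
    dirDeriv hU v (dirDeriv hU w f) = dirDeriv hU w (dirDeriv hU v f) := by
  have key : ∀ (v w : E) (x : U), eval x (dirDeriv hU v (dirDeriv hU w f)) =
      fderiv ℝ (fderiv ℝ (rep f)) x v w := fun v w x => by
    rw [eval_dirDeriv hU v (F := fun y => fderiv ℝ (rep f) y w)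
      (fun y => (eval_dirDeriv hU w (rep_eval f) y).symm)]
    have hd : DifferentiableAt ℝ (fderiv ℝ (rep f)) x :=
      (((contDiffOn_rep f).fderiv_of_isOpen hU (m := ∞) le_rfl).contDiffAt
        (hU.mem_nhds x.2)).differentiableAt (by simp)
    rw [fderiv_clm_apply hd (differentiableAt_const _)]
    simp
  refine ext_eval fun x => ?_
  rw [key, key]
  have := ((contDiffOn_rep f).contDiffAt (hU.mem_nhds x.2)).isSymmSndFDerivAt (by
    rw [minSmoothness_of_isRCLikeNormedField]; exact WithTop.coe_le_coe.mpr le_top)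
  exact this.eq v w

/-- Complex conjugation. -/
def conj : smoothAlgebra U →+* smoothAlgebra U where
  toFun f := mk (fun x => starRingEnd ℂ (rep f x))
    (Complex.conjCLE.contDiff.comp_contDiffOn (contDiffOn_rep f))
  map_one' := ext' fun x => (congrArg _ (rep_apply 1 x)).trans (map_one _)
  map_mul' f f' := ext' fun x => (congrArg _ (rep_apply (f * f') x)).trans <|
    (map_mul _ _ _).trans <| congrArg₂ (fun a b => starRingEnd ℂ a * starRingEnd ℂ b)
      (rep_apply f x).symm (rep_apply f' x).symm
  map_zero' := ext' fun x => (congrArg _ (rep_apply 0 x)).trans (map_zero _)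
  map_add' f f' := ext' fun x => (congrArg _ (rep_apply (f + f') x)).trans <|
    (map_add _ _ _).trans <| congrArg₂ (fun a b => starRingEnd ℂ a + starRingEnd ℂ b)
      (rep_apply f x).symm (rep_apply f' x).symm

@[simp] lemma eval_conj (f : smoothAlgebra U) (x : U) :
    eval x (conj f) = starRingEnd ℂ (eval x f) := by
  change starRingEnd ℂ (rep f x) = _
  rw [rep_eval]

lemma conj_dirDeriv (hU : IsOpen U) (v : E) (f : smoothAlgebra U) :
    conj (dirDeriv hU v f) = dirDeriv hU v (conj f) := by
  refine ext_eval fun x => ?_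
  rw [eval_conj, eval_dirDeriv hU v (rep_eval f),
    eval_dirDeriv hU v (F := fun y => Complex.conjCLE (rep f y)) (fun y => by
      rw [eval_conj, rep_eval]; rfl)]
  have := (Complex.conjCLE.toContinuousLinearMap.hasFDerivAt.comp (x : E)
    (differentiableAt_rep hU f x).hasFDerivAt).fderiv
  have h2 : fderiv ℝ (fun y => Complex.conjCLE (rep f y)) x = _ := this
  rw [h2]
  rfl

lemma conj_smul (c : ℂ) (f : smoothAlgebra U) : conj (c • f) = starRingEnd ℂ c • conj f :=
  ext_eval fun x => by simp only [eval_conj, eval_smul, map_mul]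

variable {n : ℕ} {U : Set (CSpace n × CSpace n)} (hU : IsOpen U)

/-- The Wirtinger derivation in the direction `v`. -/
def wDeriv (v : CSpace n × CSpace n) : Derivation ℂ (smoothAlgebra U) (smoothAlgebra U) :=
  (1 / 2 : ℂ) • (dirDeriv hU v - Complex.I • dirDeriv hU (Complex.I • v))

/-- The conjugate Wirtinger derivation in the direction `v`. -/
def wbDeriv (v : CSpace n × CSpace n) : Derivation ℂ (smoothAlgebra U) (smoothAlgebra U) :=
  (1 / 2 : ℂ) • (dirDeriv hU v + Complex.I • dirDeriv hU (Complex.I • v))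

lemma wDeriv_apply (v : CSpace n × CSpace n) (f : smoothAlgebra U) : wDeriv hU v f =
    (1 / 2 : ℂ) • (dirDeriv hU v f - Complex.I • dirDeriv hU (Complex.I • v) f) := rfl

lemma wbDeriv_apply (v : CSpace n × CSpace n) (f : smoothAlgebra U) : wbDeriv hU v f =
    (1 / 2 : ℂ) • (dirDeriv hU v f + Complex.I • dirDeriv hU (Complex.I • v) f) := rfl

lemma eval_wDeriv (v : CSpace n × CSpace n) {f : smoothAlgebra U} {F : CSpace n × CSpace n → ℂ}
    (h : ∀ x : U, F x = eval x f) (x : U) : eval x (wDeriv hU v f) = wirtinger v F x := by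
  rw [wDeriv_apply, eval_smul, map_sub, eval_smul, eval_dirDeriv hU _ h, eval_dirDeriv hU _ h,
    wirtinger]
  ring

lemma eval_wbDeriv (v : CSpace n × CSpace n) {f : smoothAlgebra U} {F : CSpace n × CSpace n → ℂ}
    (h : ∀ x : U, F x = eval x f) (x : U) : eval x (wbDeriv hU v f) = wirtingerBar v F x := by
  rw [wbDeriv_apply, eval_smul, map_add, eval_smul, eval_dirDeriv hU _ h, eval_dirDeriv hU _ h,
    wirtingerBar]
  ring

lemma wDeriv_wDeriv (v w : CSpace n × CSpace n) (f : smoothAlgebra U) :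
    wDeriv hU v (wDeriv hU w f) = wDeriv hU w (wDeriv hU v f) := by
  simp only [wDeriv_apply, Derivation.map_smul, map_sub, smul_sub, smul_smul]
  rw [dirDeriv_comm hU v w, dirDeriv_comm hU v _, dirDeriv_comm hU _ w,
    dirDeriv_comm hU (Complex.I • v) (Complex.I • w)]
  module

lemma wDeriv_wbDeriv (v w : CSpace n × CSpace n) (f : smoothAlgebra U) :
    wDeriv hU v (wbDeriv hU w f) = wbDeriv hU w (wDeriv hU v f) := by
  simp only [wDeriv_apply, wbDeriv_apply, Derivation.map_smul, map_sub, map_add, smul_sub,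
    smul_add, smul_smul]
  rw [dirDeriv_comm hU v w, dirDeriv_comm hU v _, dirDeriv_comm hU _ w,
    dirDeriv_comm hU (Complex.I • v) (Complex.I • w)]
  module

lemma wbDeriv_wbDeriv (v w : CSpace n × CSpace n) (f : smoothAlgebra U) :
    wbDeriv hU v (wbDeriv hU w f) = wbDeriv hU w (wbDeriv hU v f) := by
  simp only [wbDeriv_apply, Derivation.map_smul, map_add, smul_add, smul_smul]
  rw [dirDeriv_comm hU v w, dirDeriv_comm hU v _, dirDeriv_comm hU _ w,
    dirDeriv_comm hU (Complex.I • v) (Complex.I • w)]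
  module

lemma conj_wDeriv (v : CSpace n × CSpace n) (f : smoothAlgebra U) :
    conj (wDeriv hU v f) = wbDeriv hU v (conj f) := by
  simp only [wDeriv_apply, wbDeriv_apply, conj_smul, map_sub, conj_dirDeriv]
  simp [Complex.conj_ofNat]

lemma conj_wbDeriv (v : CSpace n × CSpace n) (f : smoothAlgebra U) :
    conj (wbDeriv hU v f) = wDeriv hU v (conj f) := by
  simp only [wDeriv_apply, wbDeriv_apply, conj_smul, map_add, conj_dirDeriv]
  simp [sub_eq_add_neg, Complex.conj_ofNat]

/-- The fibre coordinate `η^k`. -/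
def coord (k : Fin n) : smoothAlgebra U :=
  mk (fun p => p.2 k) (by fun_prop)

lemma eval_dirDeriv_coord (k : Fin n) (v : CSpace n × CSpace n) (x : U) :
    eval x (dirDeriv hU v (coord k)) = v.2 k := by
  rw [eval_dirDeriv hU v (F := fun p => p.2 k) (fun _ => rfl)]
  have : (fun p : CSpace n × CSpace n => p.2 k) = ((ContinuousLinearMap.proj k).comp
      (ContinuousLinearMap.snd ℝ (CSpace n) (CSpace n))) := rfl
  rw [this, ContinuousLinearMap.fderiv]
  rfl

lemma wDeriv_coord (k : Fin n) (v : CSpace n × CSpace n) :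
    wDeriv hU v (coord k) = algebraMap ℂ _ (v.2 k) := by
  refine ext_eval fun x => ?_
  rw [wDeriv_apply, eval_smul, map_sub, eval_smul, eval_dirDeriv_coord, eval_dirDeriv_coord,
    eval_algebraMap]
  simp only [Prod.smul_snd, Pi.smul_apply, smul_eq_mul, ← mul_assoc, Complex.I_mul_I]
  ring

lemma wbDeriv_coord (k : Fin n) (v : CSpace n × CSpace n) :
    wbDeriv hU v (coord k) = 0 := by
  refine ext_eval fun x => ?_
  rw [wbDeriv_apply, eval_smul, map_add, eval_smul, eval_dirDeriv_coord, eval_dirDeriv_coord]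
  simp [← mul_assoc]

end smoothAlgebra

end

end CFinsler

/-! ### Realisation of the formal calculus by a metric in coordinates -/

namespace CFinsler

noncomputable section

open smoothAlgebra

variable {n : ℕ} {U : Set (CSpace n × CSpace n)} {L : CSpace n × CSpace n → ℝ}

/-- The coordinate expression `L` of a squared complex Finsler metric on an open set `U`. -/
structure IsLocalFinsler (U : Set (CSpace n × CSpace n)) (L : CSpace n × CSpace n → ℝ) : Prop where
  isOpen : IsOpen U
  smooth : ContDiffOn ℝ ∞ L U
  ne_zero : ∀ p ∈ U, L p ≠ 0
  euler : ∀ p ∈ U, ∑ k, p.2 k * dEta k (fun q => (L q : ℂ)) p = L p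
  isUnit_det : ∀ p ∈ U, IsUnit (gMatrix L p).det

namespace IsLocalFinsler

variable (hL : IsLocalFinsler U L)

/-- The squared metric as an element of the algebra of smooth functions. -/
def metric : smoothAlgebra U :=
  smoothAlgebra.mk (fun p => (L p : ℂ)) (Complex.ofRealCLM.contDiff.comp_contDiffOn hL.smooth)

lemma eval_metric (p : U) : eval p hL.metric = (L p : ℂ) := rfl

/-- The fundamental matrix with entries in the algebra of smooth functions. -/
def matrix : Matrix (Fin n) (Fin n) (smoothAlgebra U) :=
  Matrix.of fun i j => wDeriv hL.isOpen (0, Pi.single i 1)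
    (wbDeriv hL.isOpen (0, Pi.single j 1) hL.metric)

lemma eval_matrix (i j : Fin n) (p : U) : eval p (hL.matrix i j) = g L i j p :=
  eval_wDeriv hL.isOpen _ (fun x => (eval_wbDeriv hL.isOpen _ (fun x => hL.eval_metric x) x).symm) p

lemma map_matrix (p : U) : (eval p).mapMatrix hL.matrix = gMatrix L p := by
  ext i j
  exact hL.eval_matrix i j p

lemma isUnit_det_matrix : IsUnit hL.matrix.det :=
  isUnit_of_ne_zero fun p => by
    rw [RingHom.map_det, hL.map_matrix]
    exact (hL.isUnit_det p p.2).ne_zero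

lemma eval_inv_matrix (m k : Fin n) (p : U) : eval p (hL.matrix⁻¹ m k) = gInv L m k p := by
  have h : (gMatrix L p)⁻¹ = (eval p).mapMatrix hL.matrix⁻¹ :=
    Matrix.inv_eq_right_inv (by
      rw [← hL.map_matrix, ← map_mul, Matrix.mul_nonsing_inv _ hL.isUnit_det_matrix, map_one])
  rw [gInv, h]
  rfl

lemma single_apply' (k j : Fin n) : (Pi.single k 1 : CSpace n) j = if k = j then 1 else 0 := by
  rw [Pi.single_apply]
  simp [eq_comm]

/-- The algebraic Finsler structure on the smooth functions on `U`. -/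
def alg : FinslerAlgebra n (smoothAlgebra U) where
  z k := wDeriv hL.isOpen (Pi.single k 1, 0)
  zb k := wbDeriv hL.isOpen (Pi.single k 1, 0)
  e k := wDeriv hL.isOpen (0, Pi.single k 1)
  eb k := wbDeriv hL.isOpen (0, Pi.single k 1)
  conj := conj
  y := coord
  L := hL.metric
  gi m k := hL.matrix⁻¹ m k
  e_e _ _ _ := wDeriv_wDeriv _ _ _ _
  eb_e _ _ _ := (wDeriv_wbDeriv _ _ _ _).symm
  z_e _ _ _ := wDeriv_wDeriv _ _ _ _
  z_eb _ _ _ := wDeriv_wbDeriv _ _ _ _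
  zb_e _ _ _ := (wDeriv_wbDeriv _ _ _ _).symm
  zb_zb _ _ _ := wbDeriv_wbDeriv _ _ _ _
  conj_e _ _ := conj_wDeriv _ _ _
  conj_eb _ _ := conj_wbDeriv _ _ _
  conj_zb _ _ := conj_wbDeriv _ _ _
  conj_L := ext_eval fun x => by rw [eval_conj, eval_metric, Complex.conj_ofReal]
  e_y i j := by
    rw [wDeriv_coord]
    change algebraMap ℂ _ ((Pi.single i 1 : CSpace n) j) = _
    rw [single_apply']
    split_ifs <;> simp
  z_y i j := by rw [wDeriv_coord]; simp
  zb_y i j := wbDeriv_coord _ _ _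
  eb_y i j := wbDeriv_coord _ _ _
  isUnit_L := isUnit_of_ne_zero fun p => by
    rw [eval_metric]
    exact_mod_cast hL.ne_zero p p.2
  euler := ext_eval fun p => by
    rw [map_sum, eval_metric, ← hL.euler p p.2]
    refine Finset.sum_congr rfl fun k _ => ?_
    rw [map_mul, eval_wDeriv hL.isOpen _ (F := fun q => (L q : ℂ)) (fun x => (hL.eval_metric x).symm)]
    rfl
  g_gi l k := by
    have := congrFun (congrFun (Matrix.mul_nonsing_inv _ hL.isUnit_det_matrix) l) k
    rwa [Matrix.mul_apply, Matrix.one_apply] at this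
  gi_g l k := by
    have := congrFun (congrFun (Matrix.nonsing_inv_mul _ hL.isUnit_det_matrix) l) k
    rwa [Matrix.mul_apply, Matrix.one_apply] at this

variable {f : smoothAlgebra U} {F : CSpace n × CSpace n → ℂ}

lemma eval_z (h : ∀ x : U, F x = eval x f) (k : Fin n) (p : U) :
    eval p (hL.alg.z k f) = dz k F p := eval_wDeriv _ _ h p

lemma eval_zb (h : ∀ x : U, F x = eval x f) (k : Fin n) (p : U) :
    eval p (hL.alg.zb k f) = dzBar k F p := eval_wbDeriv _ _ h p

lemma eval_e (h : ∀ x : U, F x = eval x f) (k : Fin n) (p : U) :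
    eval p (hL.alg.e k f) = dEta k F p := eval_wDeriv _ _ h p

lemma eval_eb (h : ∀ x : U, F x = eval x f) (k : Fin n) (p : U) :
    eval p (hL.alg.eb k f) = dEtaBar k F p := eval_wbDeriv _ _ h p

lemma eval_y (k : Fin n) (p : U) : eval p (hL.alg.y k) = p.1.2 k := rfl

lemma eval_g (i j : Fin n) (p : U) : eval p (hL.alg.g i j) = g L i j p := hL.eval_matrix i j p

lemma eval_gi (m k : Fin n) (p : U) : eval p (hL.alg.gi m k) = gInv L m k p :=
  hL.eval_inv_matrix m k p

lemma eval_N (k j : Fin n) (p : U) : eval p (hL.alg.N k j) = nonlin L k j p := by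
  simp only [FinslerAlgebra.N, nonlin, map_sum, map_mul, eval_gi, eval_y,
    hL.eval_z (fun x => (hL.eval_g _ _ x).symm)]

lemma eval_delta (h : ∀ x : U, F x = eval x f) (k : Fin n) (p : U) :
    eval p (hL.alg.delta k f) = delta L k F p := by
  simp only [FinslerAlgebra.delta_apply, delta, map_sub, map_sum, map_mul, eval_N,
    hL.eval_z h, hL.eval_e h]

lemma eval_deltaBar (h : ∀ x : U, F x = eval x f) (k : Fin n) (p : U) :
    eval p (hL.alg.deltaBar k f) = deltaBar L k F p := by
  have hc : ∀ f, eval p (hL.alg.conj f) = starRingEnd ℂ (eval p f) := fun f => eval_conj f p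
  simp only [FinslerAlgebra.deltaBar_apply, deltaBar, map_sub, map_sum, map_mul, hc, eval_N,
    hL.eval_zb h, hL.eval_eb h]

lemma eval_H (i j k : Fin n) (p : U) : eval p (hL.alg.H i j k) = horCoeff L i j k p := by
  simp only [FinslerAlgebra.H, horCoeff, map_sum, map_mul, eval_gi,
    hL.eval_delta (fun x => (hL.eval_g _ _ x).symm)]

lemma eval_C (i j k : Fin n) (p : U) : eval p (hL.alg.C i j k) = verCoeff L i j k p := by
  simp only [FinslerAlgebra.C, verCoeff, map_sum, map_mul, eval_gi,
    hL.eval_e (fun x => (hL.eval_g _ _ x).symm)]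

lemma eval_T (i j k : Fin n) (p : U) : eval p (hL.alg.T i j k) = torsion L i j k p := by
  simp only [FinslerAlgebra.T, torsion, map_sub, eval_H]

lemma eval_Rup (i j h k : Fin n) (p : U) : eval p (hL.alg.Rup i j h k) = curvUp L i j h k p := by
  simp only [FinslerAlgebra.Rup, curvUp, map_sub, map_neg, map_sum, map_mul, eval_C,
    hL.eval_deltaBar (fun x => (hL.eval_H _ _ _ x).symm),
    hL.eval_deltaBar (fun x => (hL.eval_N _ _ x).symm)]

lemma eval_R (r j h k : Fin n) (p : U) : eval p (hL.alg.R r j h k) = curv L r j h k p := by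
  simp only [FinslerAlgebra.R, curv, map_sum, map_mul, eval_g, eval_Rup]

end IsLocalFinsler

/-! ### The curvature factor in a chart -/

/-- A real function is the curvature factor on `U`. -/
def IsCurvatureFactor (U : Set (CSpace n × CSpace n)) (L K : CSpace n × CSpace n → ℝ) : Prop :=
  ∀ p ∈ U, ∀ r j h k : Fin n, curv L r j h k p =
    (K p : ℂ) * (g L j r p * g L k h p + g L k r p * g L j h p)

/-- A real function whose Wirtinger derivative vanishes in the direction `v` has vanishing
derivative in the directions `v` and `I • v`. -/
lemma fderiv_eq_zero_of_wirtinger {K : CSpace n × CSpace n → ℝ} {p v : CSpace n × CSpace n}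
    (hd : DifferentiableAt ℝ K p) (h : wirtinger v (fun q => (K q : ℂ)) p = 0) :
    fderiv ℝ K p v = 0 ∧ fderiv ℝ K p (Complex.I • v) = 0 := by
  have h1 : fderiv ℝ (fun q => (K q : ℂ)) p = Complex.ofRealCLM.comp (fderiv ℝ K p) :=
    (Complex.ofRealCLM.hasFDerivAt.comp p hd.hasFDerivAt).fderiv
  rw [wirtinger, h1] at h
  have h2 := congrArg Complex.re h
  have h3 := congrArg Complex.im h
  simp at h2 h3
  exact ⟨h2, h3⟩

/-- A real linear form on `ℂⁿ` that vanishes on all `e_k` and `i e_k` is zero. -/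
lemma clm_eq_zero {W : Type*} [NormedAddCommGroup W] [NormedSpace ℝ W] (A : CSpace n →L[ℝ] W)
    (h : ∀ k, A (Pi.single k 1) = 0 ∧ A (Complex.I • Pi.single k 1) = 0) : A = 0 := by
  ext v
  have hv : v = ∑ k, ((v k).re • (Pi.single k 1 : CSpace n) +
      (v k).im • (Complex.I • (Pi.single k 1 : CSpace n))) := by
    ext j
    simp [Finset.sum_apply, Pi.single_apply, Finset.sum_add_distrib]
  rw [hv]
  simp [h]

namespace IsCurvatureFactor

variable {K : CSpace n × CSpace n → ℝ}

/-- No regularity of K is assumed; the identity with all indices 0 reads R = 2 K g_{00̄}², and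
dividing by the nonvanishing 2 g_{00̄}² exhibits K as smooth. -/
lemma exists_smooth [NeZero n] (hK : IsCurvatureFactor U L K) (hL : IsLocalFinsler U L)
    (hg : ∀ p ∈ U, g L 0 0 p ≠ 0) : ∃ f : smoothAlgebra U, (∀ p : U, eval p f = (K p : ℂ)) ∧
      hL.alg.HasFactor f ∧ hL.alg.conj f = f := by
  obtain ⟨u, hu⟩ : IsUnit (2 * (hL.alg.g 0 0 * hL.alg.g 0 0)) :=
    isUnit_of_ne_zero fun p => by
      simp only [map_mul, map_ofNat, hL.eval_g]
      have := hg p p.2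
      simp [this]
  have key : ∀ p : U, eval p (hL.alg.R 0 0 0 0 * ↑u⁻¹) = (K p : ℂ) := fun p => by
    have h1 : eval p (u : smoothAlgebra U) * eval p (↑u⁻¹ : smoothAlgebra U) = 1 := by
      rw [← map_mul, Units.mul_inv, map_one]
    rw [hu] at h1
    simp only [map_mul, map_ofNat, hL.eval_g] at h1
    rw [map_mul, hL.eval_R, hK p p.2]
    linear_combination (K p : ℂ) * h1
  refine ⟨_, key, fun r j h k => ext_eval fun p => ?_, ext_eval fun p => ?_⟩
  · simp only [map_mul _ (_ * _) (_ + _), key, map_add, map_mul _ (FinslerAlgebra.g _ _ _), hL.eval_g,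
      hL.eval_R, hK p p.2]
  · have : ∀ f, eval p (hL.alg.conj f) = starRingEnd ℂ (eval p f) := fun f => eval_conj f p
    rw [this, key, Complex.conj_ofReal]

lemma contDiffOn [NeZero n] (hK : IsCurvatureFactor U L K) (hL : IsLocalFinsler U L)
    (hg : ∀ p ∈ U, g L 0 0 p ≠ 0) : ContDiffOn ℝ ∞ K U := by
  obtain ⟨f, hf, -⟩ := hK.exists_smooth hL hg
  have h1 : ContDiffOn ℝ ∞ (fun p => (rep f p).re) U :=
    Complex.reCLM.contDiff.comp_contDiffOn (contDiffOn_rep f)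
  refine h1.congr fun p hp => ?_
  rw [rep_eval f ⟨p, hp⟩, hf]
  simp


lemma fderiv_vertical [NeZero n] (hK : IsCurvatureFactor U L K) (hL : IsLocalFinsler U L)
    (hg : ∀ p ∈ U, g L 0 0 p ≠ 0) {p : CSpace n × CSpace n} (hp : p ∈ U) :
    (fderiv ℝ K p).comp (.inr ℝ (CSpace n) (CSpace n)) = 0 := by
  obtain ⟨f, hf, hfac, -⟩ := hK.exists_smooth hL hg
  refine clm_eq_zero _ fun k => ?_
  have hd : DifferentiableAt ℝ K p :=
    ((hK.contDiffOn hL hg).contDiffAt (hL.isOpen.mem_nhds hp)).differentiableAt (by simp)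
  have h0 := hL.eval_e (F := fun q => (K q : ℂ)) (fun x => (hf x).symm) k ⟨p, hp⟩
  rw [hfac.e_factor, map_zero] at h0
  have := fderiv_eq_zero_of_wirtinger hd h0.symm
  simpa using this

lemma torsion_eq_zero [NeZero n] (hK : IsCurvatureFactor U L K) (hL : IsLocalFinsler U L)
    (hg : ∀ p ∈ U, g L 0 0 p ≠ 0) {c : ℝ} (hc : c ≠ 0) (hKc : ∀ p ∈ U, K p = c)
    {p : CSpace n × CSpace n} (hp : p ∈ U) (i j k : Fin n) : torsion L i j k p = 0 := by
  obtain ⟨f, hf, hfac, hconj⟩ := hK.exists_smooth hL hg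
  have hfu : IsUnit f := isUnit_of_ne_zero fun p => by
    rw [hf, hKc p p.2]
    exact_mod_cast hc
  have hfc : f = algebraMap ℂ _ (c : ℂ) := ext_eval fun x => by
    rw [hf, hKc x x.2, eval_algebraMap]
  have := hfac.T_eq_zero hfu hconj (fun k => by rw [hfc, Derivation.map_algebraMap]) i j k
  rw [← hL.eval_T i j k ⟨p, hp⟩, this, map_zero]

/-- By `z_mul_y` the rank-one matrix (∂K/∂z^l) η^m is a multiple of the identity, hence zero in
dimension at least two; as η ≠ 0, the gradient vanishes. -/
lemma fderiv_horizontal [NeZero n] [Nontrivial (Fin n)] (hK : IsCurvatureFactor U L K)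
    (hL : IsLocalFinsler U L) (hg : ∀ p ∈ U, g L 0 0 p ≠ 0) (hK0 : ∀ p ∈ U, K p ≠ 0)
    (hT : ∀ p ∈ U, ∀ i k, ∑ j, torsion L i j k p * p.2 j = 0)
    {p : CSpace n × CSpace n} (hp : p ∈ U) (hp2 : p.2 ≠ 0) :
    (fderiv ℝ K p).comp (.inl ℝ (CSpace n) (CSpace n)) = 0 := by
  obtain ⟨f, hf, hfac, hconj⟩ := hK.exists_smooth hL hg
  have hfu : IsUnit f := isUnit_of_ne_zero fun p => by
    rw [hf]
    exact_mod_cast hK0 p p.2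
  have key := fun l m => congrArg (eval ⟨p, hp⟩) <| hfac.z_mul_y hfu hconj (fun i k =>
    ext_eval fun x => by
      simp only [map_sum, map_mul, hL.eval_T, hL.eval_y, hT x x.2, map_zero]) l m
  simp only [map_mul, hL.eval_y] at key
  obtain ⟨m, hm⟩ : ∃ m, p.2 m ≠ 0 := by
    by_contra! h
    exact hp2 (funext h)
  have hne : ∀ l, l ≠ m → eval ⟨p, hp⟩ (hL.alg.z l f) = 0 := fun l hl => by
    have := key l m
    rw [if_neg hl, map_zero] at this
    exact (mul_eq_zero.mp this).resolve_right hm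
  have hz : ∀ l, eval ⟨p, hp⟩ (hL.alg.z l f) = 0 := fun l => by
    by_cases hl : l = m
    -- A second index is where dimension at least two enters: the diagonal entries are all equal,
    -- and the one at l' is zero.
    · obtain ⟨l', hl'⟩ := exists_ne m
      have h1 := key l' l'
      have h2 := key m m
      rw [if_pos rfl, hne l' hl', zero_mul] at h1
      rw [if_pos rfl, ← h1] at h2
      rw [hl]
      exact (mul_eq_zero.mp h2).resolve_right hm
    · exact hne l hl
  refine clm_eq_zero _ fun k => ?_
  have hd : DifferentiableAt ℝ K p :=
    ((hK.contDiffOn hL hg).contDiffAt (hL.isOpen.mem_nhds hp)).differentiableAt (by simp)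
  have h0 := hL.eval_z (F := fun q => (K q : ℂ)) (fun x => (hf x).symm) k ⟨p, hp⟩
  rw [hz] at h0
  have := fderiv_eq_zero_of_wirtinger hd h0.symm
  simpa using this

end IsCurvatureFactor
end
end CFinsler

/-! ### From charts to the manifold -/

namespace CFinsler

open Topology

section Manifold

variable {n : ℕ} {M : Type*} [TopologicalSpace M] [ChartedSpace (CSpace n) M]
  [IsManifold 𝓘(ℂ, CSpace n) ω M] {φ : OpenPartialHomeomorph M (CSpace n)}

lemma mfderiv_symm_bijective (hφ : φ ∈ atlas (CSpace n) M) {z : CSpace n} (hz : z ∈ φ.target) :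
    Function.Bijective (mfderiv 𝓘(ℂ, CSpace n) 𝓘(ℂ, CSpace n) φ.symm z) :=
  (mdifferentiable_of_mem_atlas (I := 𝓘(ℂ, CSpace n)) hφ).symm.mfderiv_bijective hz

lemma tangentPoint_snd_ne_zero (hφ : φ ∈ atlas (CSpace n) M) {p : CSpace n × CSpace n}
    (hp : p ∈ slitDomain φ) : (tangentPoint φ p).2 ≠ 0 := fun h =>
  hp.2 ((mfderiv_symm_bijective hφ hp.1).1 (h.trans (map_zero _).symm))

lemma exists_tangentPoint_eq (hφ : φ ∈ atlas (CSpace n) M) {z : CSpace n} (hz : z ∈ φ.target)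
    (v : TangentSpace 𝓘(ℂ, CSpace n) (φ.symm z)) (hv : v ≠ 0) :
    ∃ η : CSpace n, η ≠ 0 ∧ tangentPoint φ (z, η) = ⟨φ.symm z, v⟩ := by
  obtain ⟨η, hη⟩ := (mfderiv_symm_bijective hφ hz).2 v
  refine ⟨η, ?_, ?_⟩
  · rintro rfl
    exact hv (hη.symm.trans (map_zero _))
  · rw [tangentPoint]
    exact congrArg (Bundle.TotalSpace.mk (φ.symm z)) hη

omit [ChartedSpace (CSpace n) M] [IsManifold 𝓘(ℂ, CSpace n) ω M] in
lemma isOpen_slitDomain (φ : OpenPartialHomeomorph M (CSpace n)) : IsOpen (slitDomain φ) :=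
  (φ.open_target.preimage continuous_fst).inter (isOpen_ne.preimage continuous_snd)

variable {F : TangentBundle 𝓘(ℂ, CSpace n) M → ℝ}

lemma IsComplexFinsler.localL_smul (hF : IsComplexFinsler F)
    (φ : OpenPartialHomeomorph M (CSpace n)) (z η : CSpace n) (c : ℂ) :
    localL F φ (z, c • η) = Complex.normSq c * localL F φ (z, η) := by
  have : tangentPoint φ (z, c • η) =
      ⟨φ.symm z, c • mfderiv 𝓘(ℂ, CSpace n) 𝓘(ℂ, CSpace n) φ.symm z η⟩ :=
    congrArg (Bundle.TotalSpace.mk (φ.symm z)) (map_smul _ c η)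
  rw [localL, this, hF.homogeneous, mul_pow, Complex.sq_norm]
  rfl

/-- Euler's identity for functions of bidegree `(1, 1)` in the fibre coordinates. -/
lemma euler_of_smul {L : CSpace n × CSpace n → ℝ} {p : CSpace n × CSpace n}
    (hd : DifferentiableAt ℝ L p)
    (h : ∀ c : ℂ, L (p.1, c • p.2) = Complex.normSq c * L p) :
    ∑ k, p.2 k * dEta k (fun q => (L q : ℂ)) p = L p := by
  have h1 : fderiv ℝ (fun q => (L q : ℂ)) p = Complex.ofRealCLM.comp (fderiv ℝ L p) :=
    (Complex.ofRealCLM.hasFDerivAt.comp p hd.hasFDerivAt).fderiv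
  have h2 : ∀ c : ℂ, fderiv ℝ L p (0, c • p.2) = 2 * c.re * L p := fun c => by
    rw [← hd.lineDeriv_eq_fderiv, lineDeriv]
    have h3 : (fun t : ℝ => L (p + t • (0, c • p.2))) =
        fun t : ℝ => ((1 + t * c.re) ^ 2 + (t * c.im) ^ 2) * L p := by
      ext t
      have h4 : p + t • ((0 : CSpace n), c • p.2) = (p.1, (1 + (t : ℂ) * c) • p.2) := by
        refine Prod.ext (by simp) ?_
        simp [add_smul, mul_smul]
      rw [h4, h, Complex.normSq_apply]
      rw [Complex.add_re, Complex.add_im, Complex.re_ofReal_mul, Complex.im_ofReal_mul,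
        Complex.one_re, Complex.one_im, zero_add]
      ring
    rw [h3]
    have h5 : HasDerivAt (fun t : ℝ => ((1 + t * c.re) ^ 2 + (t * c.im) ^ 2) * L p)
        ((2 * (1 + 0 * c.re) ^ 1 * (1 * c.re) + 2 * (0 * c.im) ^ 1 * (1 * c.im)) * L p) 0 :=
      (((((hasDerivAt_id (0 : ℝ)).mul_const c.re).const_add 1).pow 2).add
        (((hasDerivAt_id (0 : ℝ)).mul_const c.im).pow 2)).mul_const (L p)
    rw [h5.deriv]
    ring
  set A := (fderiv ℝ L p).comp (.inr ℝ (CSpace n) (CSpace n)) with hA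
  have h6 : ∀ v, fderiv ℝ L p (0, v) = A v := fun v => rfl
  have hexp : ∀ c : ℂ, A (c • p.2) = ∑ k, ((c * p.2 k).re * A (Pi.single k 1) +
      (c * p.2 k).im * A (Complex.I • Pi.single k 1)) := fun c => by
    have hv : c • p.2 = ∑ k, ((c * p.2 k).re • (Pi.single k 1 : CSpace n) +
        (c * p.2 k).im • (Complex.I • (Pi.single k 1 : CSpace n))) := by
      ext j
      rw [Finset.sum_apply, Finset.sum_eq_single j]
      · simp only [Pi.smul_apply, Pi.add_apply, Pi.single_eq_same, smul_eq_mul, mul_one,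
          Complex.real_smul]
        exact (Complex.re_add_im _).symm
      · intro k _ hk
        simp [hk.symm]
      · simp
    conv_lhs => rw [hv]
    simp
  -- The derivatives along η and iη are 2L and 0; their Wirtinger combination (2L - i·0)/2 is L.
  have h7 := (h6 _).symm.trans (h2 1)
  have h8 := (h6 _).symm.trans (h2 Complex.I)
  rw [hexp] at h7 h8
  have h9 : ∀ k, p.2 k * dEta k (fun q => (L q : ℂ)) p =
      ((((1 * p.2 k).re * A (Pi.single k 1) + (1 * p.2 k).im * A (Complex.I • Pi.single k 1) : ℝ) : ℂ)
      - Complex.I * (((Complex.I * p.2 k).re * A (Pi.single k 1) +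
        (Complex.I * p.2 k).im * A (Complex.I • Pi.single k 1) : ℝ) : ℂ)) / 2 := fun k => by
    rw [dEta, wirtinger, h1, Prod.smul_mk, smul_zero]
    simp only [ContinuousLinearMap.comp_apply, h6, Complex.ofRealCLM_apply]
    apply Complex.ext <;> simp <;> ring
  simp only [h9]
  rw [← Finset.sum_div, Finset.sum_sub_distrib, ← Finset.mul_sum, ← Complex.ofReal_sum,
    ← Complex.ofReal_sum, h7, h8]
  simp

lemma IsComplexFinsler.isLocalFinsler (hF : IsComplexFinsler F) (hφ : φ ∈ atlas (CSpace n) M)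
    {U : Set (CSpace n × CSpace n)} (hU : IsOpen U) (hUφ : U ⊆ slitDomain φ) :
    IsLocalFinsler U (localL F φ) where
  isOpen := hU
  smooth := (hF.smooth φ hφ).mono hUφ
  ne_zero p hp := pow_ne_zero 2 fun h =>
    tangentPoint_snd_ne_zero hφ (hUφ hp) ((hF.eq_zero_iff _).mp h)
  euler p hp := euler_of_smul
    (((hF.smooth φ hφ).contDiffAt ((isOpen_slitDomain φ).mem_nhds (hUφ hp))).differentiableAt
      (by simp)) fun c => hF.localL_smul φ p.1 p.2 c
  isUnit_det p hp := (Matrix.isUnit_iff_isUnit_det _).mp (hF.posDef φ hφ p (hUφ hp)).isUnit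

lemma IsComplexFinsler.g_diag_ne_zero (hF : IsComplexFinsler F) (hφ : φ ∈ atlas (CSpace n) M)
    {p : CSpace n × CSpace n} (hp : p ∈ slitDomain φ) (i : Fin n) : g (localL F φ) i i p ≠ 0 :=
  (hF.posDef φ hφ p hp).diag_pos.ne'

variable {𝒦 : TangentBundle 𝓘(ℂ, CSpace n) M → ℝ}

omit [IsManifold 𝓘(ℂ, CSpace n) ω M] in
lemma HasCurvatureFactor.isCurvatureFactor (hR : HasCurvatureFactor F 𝒦)
    (hφ : φ ∈ atlas (CSpace n) M) {U : Set (CSpace n × CSpace n)} (hUφ : U ⊆ slitDomain φ) :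
    IsCurvatureFactor U (localL F φ) (fun p => 𝒦 (tangentPoint φ p)) :=
  fun p hp => hR φ hφ p (hUφ hp)

lemma HasCurvatureFactor.contDiffOn [NeZero n] (hR : HasCurvatureFactor F 𝒦)
    (hF : IsComplexFinsler F) (hφ : φ ∈ atlas (CSpace n) M) :
    ContDiffOn ℝ ∞ (fun p => 𝒦 (tangentPoint φ p)) (slitDomain φ) :=
  (hR.isCurvatureFactor hφ subset_rfl).contDiffOn
    (hF.isLocalFinsler hφ (isOpen_slitDomain φ) subset_rfl) fun _ hp => hF.g_diag_ne_zero hφ hp 0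

lemma HasCurvatureFactor.differentiableAt [NeZero n] (hR : HasCurvatureFactor F 𝒦)
    (hF : IsComplexFinsler F) (hφ : φ ∈ atlas (CSpace n) M) {p : CSpace n × CSpace n}
    (hp : p ∈ slitDomain φ) : DifferentiableAt ℝ (fun p => 𝒦 (tangentPoint φ p)) p :=
  ((hR.contDiffOn hF hφ).contDiffAt ((isOpen_slitDomain φ).mem_nhds hp)).differentiableAt (by simp)

/-- The curvature factor is constant on the punctured fibres. -/
lemma HasCurvatureFactor.eq_of_fst_eq [NeZero n] (hR : HasCurvatureFactor F 𝒦)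
    (hF : IsComplexFinsler F) (hφ : φ ∈ atlas (CSpace n) M) {z η η' : CSpace n}
    (hz : z ∈ φ.target) (hη : η ≠ 0) (hη' : η' ≠ 0) :
    𝒦 (tangentPoint φ (z, η)) = 𝒦 (tangentPoint φ (z, η')) := by
  -- Real rank above one makes the punctured fibre connected, so a vanishing vertical derivative
  -- suffices.
  have hrank : 1 < Module.rank ℝ (CSpace n) := by
    rw [← Module.finrank_eq_rank]
    have : Module.finrank ℝ (CSpace n) = n * 2 := by
      rw [Module.finrank_pi_fintype]
      simp
    rw [this]
    have := NeZero.pos n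
    exact_mod_cast (by omega : 1 < n * 2)
  have hd : ∀ ζ ∈ ({0}ᶜ : Set (CSpace n)), HasFDerivAt
      (fun ζ => 𝒦 (tangentPoint φ (z, ζ))) (0 : CSpace n →L[ℝ] ℝ) ζ := fun ζ hζ => by
    have hp : (z, ζ) ∈ slitDomain φ := ⟨hz, hζ⟩
    rw [← (hR.isCurvatureFactor hφ subset_rfl).fderiv_vertical
      (hF.isLocalFinsler hφ (isOpen_slitDomain φ) subset_rfl)
      (fun _ hp => hF.g_diag_ne_zero hφ hp 0) hp]
    exact (hR.differentiableAt hF hφ hp).hasFDerivAt.comp ζ (hasFDerivAt_prodMk_right z ζ)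
  exact isOpen_compl_singleton.is_const_of_fderiv_eq_zero (𝕜 := ℝ)
    (isConnected_compl_singleton_of_one_lt_rank hrank 0).isPreconnected
    (fun ζ hζ => (hd ζ hζ).differentiableAt.differentiableWithinAt)
    (fun ζ hζ => (hd ζ hζ).fderiv) hη hη'

/-- The curvature factor as a function on the base. -/
def baseFactor (𝒦 : TangentBundle 𝓘(ℂ, CSpace n) M → ℝ) (x : M) : ℝ :=
  𝒦 ⟨x, (fun _ => 1 : CSpace n)⟩

lemma one_ne_zero' [NeZero n] : (fun _ => 1 : CSpace n) ≠ 0 := fun h =>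
  one_ne_zero (congrFun h 0)

/-- The vector (1, …, 1) in `baseFactor` is only some nonzero tangent vector: it is the image of a
nonzero η' under the chart differential, and the factor is constant on the punctured fibre. -/
lemma HasCurvatureFactor.baseFactor_eq [NeZero n] (hR : HasCurvatureFactor F 𝒦)
    (hF : IsComplexFinsler F) (hφ : φ ∈ atlas (CSpace n) M) {z η : CSpace n}
    (hz : z ∈ φ.target) (hη : η ≠ 0) :
    baseFactor 𝒦 (φ.symm z) = 𝒦 (tangentPoint φ (z, η)) := by
  obtain ⟨η', hη', h⟩ := exists_tangentPoint_eq hφ hz (fun _ => 1 : CSpace n) one_ne_zero'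
  rw [hR.eq_of_fst_eq hF hφ hz hη hη', h]
  rfl

lemma HasCurvatureFactor.eq_baseFactor [NeZero n] (hR : HasCurvatureFactor F 𝒦)
    (hF : IsComplexFinsler F) (v : TangentBundle 𝓘(ℂ, CSpace n) M) (hv : v.2 ≠ 0) :
    𝒦 v = baseFactor 𝒦 v.1 := by
  obtain ⟨x, v⟩ := v
  obtain ⟨φ, hφ, z, hz, rfl⟩ : ∃ φ ∈ atlas (CSpace n) M, ∃ z ∈ φ.target, φ.symm z = x :=
    have hx := mem_chart_source (CSpace n) x
    ⟨_, chart_mem_atlas _ x, _, (chartAt (CSpace n) x).map_source hx,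
      (chartAt (CSpace n) x).left_inv hx⟩
  obtain ⟨η, hη, h⟩ := exists_tangentPoint_eq hφ hz v hv
  exact (congrArg 𝒦 h).symm.trans (hR.baseFactor_eq hF hφ hz hη).symm

lemma HasCurvatureFactor.continuous_baseFactor [NeZero n] (hR : HasCurvatureFactor F 𝒦)
    (hF : IsComplexFinsler F) : Continuous (baseFactor 𝒦 : M → ℝ) := by
  refine continuous_iff_continuousAt.mpr fun x => ?_
  set φ := chartAt (CSpace n) x
  have hφ : φ ∈ atlas (CSpace n) M := chart_mem_atlas _ x
  have hx : x ∈ φ.source := mem_chart_source _ x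
  have h1 : ContinuousAt (fun y => 𝒦 (tangentPoint φ (φ y, fun _ => 1))) x :=
    ContinuousAt.comp (f := fun y => (φ y, (fun _ => 1 : CSpace n)))
      (g := fun p => 𝒦 (tangentPoint φ p))
      (hR.differentiableAt hF hφ ⟨φ.map_source hx, one_ne_zero'⟩).continuousAt
      ((φ.continuousAt hx).prodMk continuousAt_const)
  refine h1.congr (Filter.eventuallyEq_of_mem (φ.open_source.mem_nhds hx) fun y hy => ?_)
  change 𝒦 (tangentPoint φ (φ y, fun _ => 1)) = _
  rw [← hR.baseFactor_eq hF hφ (φ.map_source hy) one_ne_zero', φ.left_inv hy]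

/-- On a Kähler space of dimension at least two the curvature factor is locally constant where it
does not vanish. -/
lemma HasCurvatureFactor.eventually_baseFactor_eq [NeZero n] [Nontrivial (Fin n)]
    (hR : HasCurvatureFactor F 𝒦) (hF : IsComplexFinsler F) (hKah : IsKahler F) {x : M}
    (hx0 : baseFactor 𝒦 x ≠ 0) : ∀ᶠ y in 𝓝 x, baseFactor 𝒦 y = baseFactor 𝒦 x := by
  set φ := chartAt (CSpace n) x
  have hφ : φ ∈ atlas (CSpace n) M := chart_mem_atlas _ x
  have hx : x ∈ φ.source := mem_chart_source _ x
  -- The horizontal argument needs K invertible, so the slit domain is shrunk to the open set where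
  -- the factor is nonzero.
  set U := slitDomain φ ∩ (fun p => 𝒦 (tangentPoint φ p)) ⁻¹' {0}ᶜ
  have hU : IsOpen U := (hR.contDiffOn hF hφ).continuousOn.isOpen_inter_preimage
    (isOpen_slitDomain φ) isOpen_compl_singleton
  have hUφ : U ⊆ slitDomain φ := Set.inter_subset_left
  set V := (fun z : CSpace n => (z, (fun _ => 1 : CSpace n))) ⁻¹' U
  have hV : IsOpen V := hU.preimage (by fun_prop)
  have hxV : φ x ∈ V := by
    refine ⟨⟨φ.map_source hx, one_ne_zero'⟩, fun h => hx0 ?_⟩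
    rw [← φ.left_inv hx, hR.baseFactor_eq hF hφ (φ.map_source hx) one_ne_zero']
    exact h
  obtain ⟨r, hr, hball⟩ := Metric.isOpen_iff.mp hV _ hxV
  have hd : ∀ z ∈ Metric.ball (φ x) r, HasFDerivAt
      (fun z => 𝒦 (tangentPoint φ (z, fun _ => 1))) (0 : CSpace n →L[ℝ] ℝ) z := fun z hz => by
    have hp : (z, (fun _ => 1 : CSpace n)) ∈ U := hball hz
    rw [← (hR.isCurvatureFactor hφ hUφ).fderiv_horizontal
      (hF.isLocalFinsler hφ hU hUφ) (fun _ hp => hF.g_diag_ne_zero hφ (hUφ hp) 0)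
      (fun p hp => hp.2) (fun p hp => hKah φ hφ p (hUφ hp)) hp one_ne_zero']
    exact HasFDerivAt.comp (g := fun p => 𝒦 (tangentPoint φ p)) z
      (hR.differentiableAt hF hφ (hUφ hp)).hasFDerivAt
      (hasFDerivAt_prodMk_left z (fun _ => 1 : CSpace n))
  have hmem : φ.source ∩ φ ⁻¹' Metric.ball (φ x) r ∈ 𝓝 x :=
    Filter.inter_mem (φ.open_source.mem_nhds hx)
      ((φ.continuousAt hx).preimage_mem_nhds (Metric.ball_mem_nhds _ hr))
  filter_upwards [hmem] with y hy
  rw [← φ.left_inv hy.1, ← φ.left_inv hx,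
    hR.baseFactor_eq hF hφ (φ.map_source hy.1) one_ne_zero',
    hR.baseFactor_eq hF hφ (φ.map_source hx) one_ne_zero']
  exact Metric.isOpen_ball.is_const_of_fderiv_eq_zero (𝕜 := ℝ)
    (f := fun z => 𝒦 (tangentPoint φ (z, fun _ => 1))) (convex_ball _ _).isPreconnected
    (fun ζ hζ => (hd ζ hζ).differentiableAt.differentiableWithinAt)
    (fun ζ hζ => (hd ζ hζ).fderiv) hy.2 (Metric.mem_ball_self hr)

/-- The level set through x is closed by continuity. It is open because the factor takes the same
nonzero value at each of its points, so local constancy applies there. -/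
lemma HasCurvatureFactor.baseFactor_const [ConnectedSpace M] [NeZero n] [Nontrivial (Fin n)]
    (hR : HasCurvatureFactor F 𝒦) (hF : IsComplexFinsler F) (hKah : IsKahler F) {x : M}
    (hx : baseFactor 𝒦 x ≠ 0) (y : M) : baseFactor 𝒦 y = baseFactor 𝒦 x := by
  have hclopen : IsClopen (baseFactor 𝒦 ⁻¹' {baseFactor 𝒦 x} : Set M) := by
    refine ⟨isClosed_singleton.preimage (hR.continuous_baseFactor hF),
      isOpen_iff_mem_nhds.mpr fun y hy => ?_⟩
    have hy' : baseFactor 𝒦 y = baseFactor 𝒦 x := hy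
    filter_upwards [hR.eventually_baseFactor_eq hF hKah (hy'.symm ▸ hx)] with w hw
    exact hw.trans hy'
  exact Set.eq_univ_iff_forall.mp (hclopen.eq_univ ⟨x, rfl⟩) y

end Manifold

end CFinsler

theorem theorem4p14 {M : Type*} [TopologicalSpace M] [ConnectedSpace M]
    [ChartedSpace (CFinsler.CSpace 2) M] [IsManifold 𝓘(ℂ, CFinsler.CSpace 2) ω M]
    (F : TangentBundle 𝓘(ℂ, CFinsler.CSpace 2) M → ℝ) (hF : CFinsler.IsComplexFinsler F)
    (𝒦 : TangentBundle 𝓘(ℂ, CFinsler.CSpace 2) M → ℝ)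
    (hR : CFinsler.HasCurvatureFactor F 𝒦)
    (h𝒦 : ∃ v : TangentBundle 𝓘(ℂ, CFinsler.CSpace 2) M, v.2 ≠ 0 ∧ 𝒦 v ≠ 0) :
    (∃ c : ℝ, ∀ v : TangentBundle 𝓘(ℂ, CFinsler.CSpace 2) M, v.2 ≠ 0 → 𝒦 v = c) ↔
      CFinsler.IsKahler F := by
  obtain ⟨v₀, hv₀, h0⟩ := h𝒦
  constructor
  · rintro ⟨c, hc⟩ φ hφ p hp i k
    -- Constancy spreads the nonvanishing at v₀ to the whole slit bundle, so the metric is Hermitian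
    -- on every chart.
    have hc0 : c ≠ 0 := hc v₀ hv₀ ▸ h0
    have hT := fun j => (hR.isCurvatureFactor hφ subset_rfl).torsion_eq_zero
      (hF.isLocalFinsler hφ (CFinsler.isOpen_slitDomain φ) subset_rfl)
      (fun _ hp => hF.g_diag_ne_zero hφ hp 0) hc0
      (fun q hq => hc _ (CFinsler.tangentPoint_snd_ne_zero hφ hq)) hp i j k
    simp [hT]
  · intro hKah
    rw [hR.eq_baseFactor hF v₀ hv₀] at h0
    exact ⟨CFinsler.baseFactor 𝒦 v₀.1, fun v hv =>
      (hR.eq_baseFactor hF v hv).trans (hR.baseFactor_const hF hKah h0 v.1)⟩
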